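/- Let $\widetilde{\mathcal P}_+^\uparrow=\mathbb R^{1+3}\rtimes \mathrm{SL}(2,\mathbb C)$ be the universal cover of the Poincaré group, acting on Minkowski space by $(a,A)x=a+\Lambda(A)x$, where $x_\sim=x_0\mathbf 1+\sum_i x_i\sigma_i$ and $(\Lambda(A)x)_\sim=Ax_\sim A^*$. Let $W_3=\{x:|x_0|<x_3\}$, $r_1(\pi)=e^{i\frac{\pi}{2}\sigma_1}$, $G_3^0=\{A\in \mathrm{SL}(2,\mathbb C):\Lambda(A)W_3=W_3\}$, $\tilde G_3^0=\langle G_3^0,r_1(\pi)\rangle$, $G_3=\mathbb R^{1+3}\rtimes G_3^0$ and $\tilde G_3=\mathbb R^{1+3}\rtimes\tilde G_3^0$. For $r>0$ and $n\in\{0,1,2,3\}$ let $$W_{r,n}=\mathrm{Ind}_{\mathbb R^{1+3}\rtimes\langle r_1(\pi)\rangle}^{\tilde G_3}(\chi_{q_r}\cdot V_n),\qquad q_r=(r,r,0,0),\quad \chi_{q_r}(x)=e^{i q_r\cdot x},\quad V_n(r_1(\pi))=i^n,$$ where $q\cdot x$ is the Minkowski product of signature $(+,-,-,-)$. For a wedge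 $W=gW_3$, $g\in\widetilde{\mathcal P}_+^\uparrow$, put $G_W=gG_3g^{-1}$, $\tilde G_W=g\tilde G_3g^{-1}$, and regard $W_{r,n}$ as the representation $h\mapsto W_{r,n}(g^{-1}hg)$ of $\tilde G_W$; let $W'$ be the (open) spacelike complement of $W$. A unitary representation $U$ of $\tilde G_W$ satisfies the modularity condition if $$U(r_W)\in U(G_W)''\quad\text{for } r_W\in\tilde G_W \text{ with } r_WW=W'.$$ Let $\mu$ be a positive Borel measure on $\mathbb R^+=(0,\infty)$ and let $r\mapsto U_r$ be a $\mu$-measurable field of unitary representations of $\tilde G_W$ on a $\mu$-measurable field of Hilbert spaces $r\mapsto\mathcal H(r)$ such that, for ($\mu$-almost) every $r$, $U_r$ is unitarily equivalent to a (finite or infinite) multiple of $W_{r,n}$ for some $n=n(r)\in\{0,1,2,3\}$. Then $U=\int^{\oplus}_{\mathbb R^+}U_r\,d\mu(r)$ satisfies the modularity condition, for every $r_W\in\tilde G_W$ with $r_WW=W'$ (such elements exist). -/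

import Mathlib

open MeasureTheory Filter Topology
open scoped ENNReal InnerProductSpace

noncomputable section

namespace MasslessMC

/-! ### Square-integrable sections -/

/-- A complex vector space `F` whose elements are read, through `ev`, as sections `x ↦ ev f x` of a
field of inner product spaces `E x` over a measure space, all of them with measurable norm. -/
structure SectionSpace {X : Type*} [MeasurableSpace X] (μ : Measure X) (E : X → Type*)
    [∀ x, NormedAddCommGroup (E x)] [∀ x, InnerProductSpace ℂ (E x)]
    (F : Type*) [AddCommGroup F] [Module ℂ F] where
  ev : F →ₗ[ℂ] (∀ x, E x)
  aemeasurable_norm : ∀ f, AEMeasurable (fun x => ‖ev f x‖) μ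

namespace SectionSpace

variable {X : Type*} [MeasurableSpace X] {μ : Measure X} {E : X → Type*}
  [∀ x, NormedAddCommGroup (E x)] [∀ x, InnerProductSpace ℂ (E x)]
  {F : Type*} [AddCommGroup F] [Module ℂ F] (Γ : SectionSpace μ E F)

/-- `∫ ‖f(x)‖² dμ(x) ∈ [0, ∞]`. -/
def energy (f : F) : ℝ≥0∞ := ∫⁻ x, ENNReal.ofReal (‖Γ.ev f x‖ ^ 2) ∂μ

lemma aemeasurable_inner (f g : F) :
    AEMeasurable (fun x => (⟪Γ.ev f x, Γ.ev g x⟫_ℂ : ℂ)) μ := by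
  have h : (fun x => (⟪Γ.ev f x, Γ.ev g x⟫_ℂ : ℂ)) = fun x =>
      (((‖Γ.ev (f + g) x‖ : ℂ) ^ 2 - (‖Γ.ev (f - g) x‖ : ℂ) ^ 2
        + ((‖Γ.ev (f - Complex.I • g) x‖ : ℂ) ^ 2 - (‖Γ.ev (f + Complex.I • g) x‖ : ℂ) ^ 2)
          * Complex.I) / 4) := by
    funext x
    rw [inner_eq_sum_norm_sq_div_four]
    simp
  rw [h]
  have hm := fun f => Complex.measurable_ofReal.comp_aemeasurable (Γ.aemeasurable_norm f)
  simp only [Function.comp_def] at hm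
  exact ((((hm _).pow_const 2).sub ((hm _).pow_const 2)).add
    ((((hm _).pow_const 2).sub ((hm _).pow_const 2)).mul_const _)).div_const _

/-- The square-integrable sections. -/
def sqInt : Submodule ℂ F where
  carrier := {f | Γ.energy f < ∞}
  zero_mem' := by simp [energy]
  add_mem' := by
    intro f g hf hg
    have hm := (Γ.aemeasurable_norm f).pow_const 2 |>.ennreal_ofReal
    have : Γ.energy (f + g) ≤ 2 * (Γ.energy f + Γ.energy g) := by
      unfold energy
      rw [← lintegral_add_left' hm, ← lintegral_const_mul' _ _ (by simp)]
      refine lintegral_mono fun x => ?_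
      rw [← ENNReal.ofReal_add (by positivity) (by positivity),
        show (2 : ℝ≥0∞) = ENNReal.ofReal 2 by simp, ← ENNReal.ofReal_mul (by norm_num)]
      refine ENNReal.ofReal_le_ofReal ?_
      have h1 : ‖Γ.ev (f + g) x‖ ≤ ‖Γ.ev f x‖ + ‖Γ.ev g x‖ := by
        simpa using norm_add_le (Γ.ev f x) (Γ.ev g x)
      nlinarith [norm_nonneg (Γ.ev (f + g) x), sq_nonneg (‖Γ.ev f x‖ - ‖Γ.ev g x‖)]
    exact this.trans_lt (ENNReal.mul_lt_top (by simp) (ENNReal.add_lt_top.2 ⟨hf, hg⟩))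
  smul_mem' := by
    intro c f hf
    have : Γ.energy (c • f) = ENNReal.ofReal (‖c‖ ^ 2) * Γ.energy f := by
      unfold energy
      rw [← lintegral_const_mul' _ _ (by simp)]
      refine lintegral_congr fun x => ?_
      rw [← ENNReal.ofReal_mul (by positivity)]
      simp [norm_smul, mul_pow]
    show Γ.energy (c • f) < ∞
    rw [this]
    exact ENNReal.mul_lt_top (by simp) hf

/-- The square-integrable sections, carrying the seminorm and semi-inner product of `L²`. -/
def PreL2 : Type _ := Γ.sqInt

/-- A square-integrable section as an element of `Γ.PreL2`. -/
def toPre (f : F) (hf : Γ.energy f < ∞) : Γ.PreL2 := ⟨f, hf⟩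

instance : AddCommGroup Γ.PreL2 := inferInstanceAs (AddCommGroup Γ.sqInt)
instance : Module ℂ Γ.PreL2 := inferInstanceAs (Module ℂ Γ.sqInt)

/-- The section underlying an element of `Γ.PreL2`. -/
def sec : Γ.PreL2 →ₗ[ℂ] F := Γ.sqInt.subtype

lemma sec_injective : Function.Injective Γ.sec := Subtype.val_injective

@[simp] lemma sec_toPre (f : F) (hf : Γ.energy f < ∞) : Γ.sec (Γ.toPre f hf) = f := rfl

lemma energy_sec_lt (f : Γ.PreL2) : Γ.energy (Γ.sec f) < ∞ := f.2

lemma integrable_sq {f : F} (hf : f ∈ Γ.sqInt) : Integrable (fun x => ‖Γ.ev f x‖ ^ 2) μ := by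
  refine ⟨((Γ.aemeasurable_norm f).pow_const 2).aestronglyMeasurable, ?_⟩
  rw [hasFiniteIntegral_iff_ofReal (Eventually.of_forall fun x => by positivity)]
  exact hf

lemma integrable_inner (f g : Γ.PreL2) :
    Integrable (fun x => (⟪Γ.ev (Γ.sec f) x, Γ.ev (Γ.sec g) x⟫_ℂ : ℂ)) μ := by
  refine ((Γ.integrable_sq (Γ.energy_sec_lt f)).add (Γ.integrable_sq (Γ.energy_sec_lt g))).mono'
    (Γ.aemeasurable_inner _ _).aestronglyMeasurable (Eventually.of_forall fun x => ?_)
  have := norm_inner_le_norm (𝕜 := ℂ) (Γ.ev (Γ.sec f) x) (Γ.ev (Γ.sec g) x)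
  simp only [Pi.add_apply]
  nlinarith [sq_nonneg (‖Γ.ev (Γ.sec f) x‖ - ‖Γ.ev (Γ.sec g) x‖), sq_nonneg (‖Γ.ev (Γ.sec f) x‖),
    sq_nonneg (‖Γ.ev (Γ.sec g) x‖)]

/-- `⟪f, g⟫ = ∫ ⟪f(x), g(x)⟫ dμ(x)`. -/
instance core : PreInnerProductSpace.Core ℂ Γ.PreL2 where
  inner f g := ∫ x, (⟪Γ.ev (Γ.sec f) x, Γ.ev (Γ.sec g) x⟫_ℂ : ℂ) ∂μ
  conj_inner_symm f g := by
    rw [← integral_conj]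
    simp
  re_inner_nonneg f := by
    have h := integral_re (Γ.integrable_inner f f)
    rw [← h]
    exact integral_nonneg fun x => inner_self_nonneg
  add_left f g h := by
    rw [← integral_add (Γ.integrable_inner f h) (Γ.integrable_inner g h)]
    refine integral_congr_ae (Eventually.of_forall fun x => ?_)
    have : Γ.sec (f + g) = (Γ.sec f) + (Γ.sec g) := rfl
    simp [this]
  smul_left f g c := by
    rw [← integral_const_mul]
    refine integral_congr_ae (Eventually.of_forall fun x => ?_)
    have : Γ.sec (c • f) = c • (Γ.sec f) := rfl
    simp [this, mul_comm]

instance : SeminormedAddCommGroup Γ.PreL2 :=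
  InnerProductSpace.Core.toSeminormedAddCommGroup (𝕜 := ℂ)

instance : InnerProductSpace ℂ Γ.PreL2 := InnerProductSpace.ofCore Γ.core

/-- The Hilbert space of square-integrable sections modulo sections that vanish almost everywhere. -/
abbrev L2 : Type _ := SeparationQuotient Γ.PreL2

lemma inner_def (f g : Γ.PreL2) :
    (⟪f, g⟫_ℂ : ℂ) = ∫ x, (⟪Γ.ev (Γ.sec f) x, Γ.ev (Γ.sec g) x⟫_ℂ : ℂ) ∂μ := rfl

lemma ofReal_norm_sq (f : Γ.PreL2) : ENNReal.ofReal (‖f‖ ^ 2) = Γ.energy (Γ.sec f) := by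
  have h1 : ‖f‖ ^ 2 = ∫ x, ‖Γ.ev (Γ.sec f) x‖ ^ 2 ∂μ := by
    rw [← inner_self_eq_norm_sq (𝕜 := ℂ), inner_def, ← integral_re (Γ.integrable_inner f f)]
    exact integral_congr_ae (Eventually.of_forall fun x => inner_self_eq_norm_sq _)
  rw [h1, ofReal_integral_eq_lintegral_ofReal (Γ.integrable_sq (Γ.energy_sec_lt f))
    (Eventually.of_forall fun x => by positivity)]
  rfl

/-- The space `L²` is complete as soon as almost everywhere pointwise limits of sections are again
represented by sections. -/
theorem completeSpace_L2
    (hlim : ∀ f : ℕ → F, (∀ᵐ x ∂μ, CauchySeq fun n => Γ.ev (f n) x) →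
      ∃ g : F, ∀ᵐ x ∂μ, Tendsto (fun n => Γ.ev (f n) x) atTop (𝓝 (Γ.ev g x))) :
    CompleteSpace Γ.L2 := by
  suffices h : CompleteSpace Γ.PreL2 from inferInstance
  refine Metric.complete_of_convergent_controlled_sequences (fun k => (1 / 4 : ℝ) ^ k)
    (fun k => by positivity) fun u hu => ?_
  have hstep : ∀ k, Γ.energy (Γ.sec (u (k + 1)) - Γ.sec (u k)) ≤ ENNReal.ofReal ((1 / 16) ^ k) := by
    intro k
    have h1 : ‖u (k + 1) - u k‖ ≤ (1 / 4 : ℝ) ^ k := by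
      rw [← dist_eq_norm]
      exact (hu k (k + 1) k (Nat.le_succ k) le_rfl).le
    have h2 := Γ.ofReal_norm_sq (u (k + 1) - u k)
    have h3 : Γ.sec (u (k + 1) - u k) = Γ.sec (u (k + 1)) - Γ.sec (u k) := rfl
    rw [h3] at h2
    rw [← h2]
    refine ENNReal.ofReal_le_ofReal ?_
    calc ‖u (k + 1) - u k‖ ^ 2 ≤ ((1 / 4 : ℝ) ^ k) ^ 2 := by gcongr
      _ = (1 / 16) ^ k := by rw [← pow_mul, mul_comm, pow_mul]; norm_num
  have hmeas : ∀ f, AEMeasurable (fun x => ENNReal.ofReal (‖Γ.ev f x‖ ^ 2)) μ := fun f =>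
    ((Γ.aemeasurable_norm f).pow_const 2).ennreal_ofReal
  have hsum : ∫⁻ x, ∑' k : ℕ, ENNReal.ofReal (4 ^ k) *
      ENNReal.ofReal (‖Γ.ev (Γ.sec (u (k + 1)) - Γ.sec (u k)) x‖ ^ 2) ∂μ ≠ ∞ := by
    rw [lintegral_tsum fun k => (hmeas _).const_mul _]
    have hle : ∀ k : ℕ, ∫⁻ x, ENNReal.ofReal (4 ^ k) *
        ENNReal.ofReal (‖Γ.ev (Γ.sec (u (k + 1)) - Γ.sec (u k)) x‖ ^ 2) ∂μ
          ≤ ENNReal.ofReal ((1 / 4) ^ k) := by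
      intro k
      rw [lintegral_const_mul' _ _ (by simp)]
      calc ENNReal.ofReal (4 ^ k) * Γ.energy (Γ.sec (u (k + 1)) - Γ.sec (u k))
          ≤ ENNReal.ofReal (4 ^ k) * ENNReal.ofReal ((1 / 16) ^ k) := by gcongr; exact hstep k
        _ = ENNReal.ofReal ((1 / 4) ^ k) := by
          rw [← ENNReal.ofReal_mul (by positivity), ← mul_pow]; norm_num
    refine ne_top_of_le_ne_top ?_ (ENNReal.tsum_le_tsum hle)
    rw [← ENNReal.ofReal_tsum_of_nonneg (fun k => by positivity)
      (summable_geometric_of_lt_one (by norm_num) (by norm_num))]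
    simp
  have hcauchy : ∀ᵐ x ∂μ, CauchySeq fun n => Γ.ev (Γ.sec (u n)) x := by
    filter_upwards [ae_lt_top' (AEMeasurable.tsum fun k => (hmeas _).const_mul _) hsum]
      with x hx
    set C := (∑' k : ℕ, ENNReal.ofReal (4 ^ k) *
      ENNReal.ofReal (‖Γ.ev (Γ.sec (u (k + 1)) - Γ.sec (u k)) x‖ ^ 2)).toReal with hC
    have hC0 : 0 ≤ C := ENNReal.toReal_nonneg
    refine cauchySeq_of_le_geometric (1 / 2) (Real.sqrt C) (by norm_num) fun k => ?_
    have h1 : 4 ^ k * ‖Γ.ev (Γ.sec (u (k + 1)) - Γ.sec (u k)) x‖ ^ 2 ≤ C := by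
      have h2 := ENNReal.toReal_mono hx.ne (ENNReal.le_tsum (f := fun k : ℕ => ENNReal.ofReal (4 ^ k) *
        ENNReal.ofReal (‖Γ.ev (Γ.sec (u (k + 1)) - Γ.sec (u k)) x‖ ^ 2)) k)
      rwa [← ENNReal.ofReal_mul (by positivity), ENNReal.toReal_ofReal (by positivity)] at h2
    have h3 : (2 ^ k * ‖Γ.ev (Γ.sec (u (k + 1)) - Γ.sec (u k)) x‖) ≤ Real.sqrt C := by
      refine Real.le_sqrt_of_sq_le ?_
      rw [mul_pow, ← pow_mul, mul_comm k 2, pow_mul]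
      norm_num
      simpa using h1
    rw [dist_comm, dist_eq_norm]
    have h4 : Γ.ev (Γ.sec (u (k + 1))) x - Γ.ev (Γ.sec (u k)) x = Γ.ev (Γ.sec (u (k + 1)) - Γ.sec (u k)) x := by simp
    rw [h4, one_div, inv_pow, ← div_eq_mul_inv, le_div_iff₀ (by positivity),
      mul_comm]
    exact h3
  obtain ⟨g, hg⟩ := hlim (fun n => Γ.sec (u n)) hcauchy
  have hfatou : ∀ k, Γ.energy (g - Γ.sec (u k)) ≤ ENNReal.ofReal ((1 / 16) ^ k) := by
    intro k
    have h1 : Γ.energy (g - Γ.sec (u k)) = ∫⁻ x, liminf (fun n =>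
        ENNReal.ofReal (‖Γ.ev (Γ.sec (u n) - Γ.sec (u k)) x‖ ^ 2)) atTop ∂μ := by
      refine lintegral_congr_ae ?_
      filter_upwards [hg] with x hx
      refine (Tendsto.liminf_eq ?_).symm
      refine ENNReal.tendsto_ofReal (Tendsto.pow (Tendsto.norm ?_) 2)
      simpa using hx.sub_const (Γ.ev (Γ.sec (u k)) x)
    rw [h1]
    refine (lintegral_liminf_le' fun n => hmeas _).trans ?_
    refine liminf_le_of_frequently_le' (Eventually.frequently ?_)
    filter_upwards [eventually_ge_atTop k] with n hn
    have h2 : ‖u n - u k‖ ≤ (1 / 4 : ℝ) ^ k := by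
      rw [← dist_eq_norm]
      exact (hu k n k hn le_rfl).le
    have h3 := Γ.ofReal_norm_sq (u n - u k)
    have h4 : Γ.sec (u n - u k) = Γ.sec (u n) - Γ.sec (u k) := rfl
    rw [h4] at h3
    refine h3.symm.le.trans (ENNReal.ofReal_le_ofReal ?_)
    calc ‖u n - u k‖ ^ 2 ≤ ((1 / 4 : ℝ) ^ k) ^ 2 := by gcongr
      _ = (1 / 16) ^ k := by rw [← pow_mul, mul_comm, pow_mul]; norm_num
  have hgmem : g ∈ Γ.sqInt := by
    have h1 : g - Γ.sec (u 0) ∈ Γ.sqInt := (hfatou 0).trans_lt (by simp)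
    simpa using Γ.sqInt.add_mem h1 (Γ.energy_sec_lt (u 0))
  refine ⟨Γ.toPre g hgmem, ?_⟩
  rw [tendsto_iff_dist_tendsto_zero]
  refine squeeze_zero (fun _ => dist_nonneg) (fun k => ?_)
    (tendsto_pow_atTop_nhds_zero_of_lt_one (r := (1 / 4 : ℝ)) (by norm_num) (by norm_num))
  rw [dist_comm, dist_eq_norm]
  have h1 := (Γ.ofReal_norm_sq (Γ.toPre g hgmem - u k)).trans_le (hfatou k)
  rw [ENNReal.ofReal_le_ofReal_iff (by positivity)] at h1
  have h2 : ((1 / 16 : ℝ)) ^ k = ((1 / 4 : ℝ) ^ k) ^ 2 := by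
    rw [← pow_mul, mul_comm, pow_mul]; norm_num
  rw [h2] at h1
  exact (sq_le_sq₀ (norm_nonneg _) (by positivity)).1 h1

variable {G : Type*} [Group G]

/-- The isometry of `L²` induced by a linear map of sections that preserves `∫ ‖f‖² dμ`. -/
def liftIsometry (T : F →ₗ[ℂ] F) (hT : ∀ f, Γ.energy (T f) = Γ.energy f) :
    Γ.L2 →ₗᵢ[ℂ] Γ.L2 :=
  let T₀ : Γ.PreL2 →ₗᵢ[ℂ] Γ.PreL2 :=
    { toFun := fun f => Γ.toPre (T (Γ.sec f)) ((hT (Γ.sec f)).trans_lt (Γ.energy_sec_lt f))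
      map_add' := fun f g => Subtype.ext (T.map_add (Γ.sec f) (Γ.sec g))
      map_smul' := fun c f => Subtype.ext (T.map_smul c (Γ.sec f))
      norm_map' := fun f => by
        have h := (Γ.ofReal_norm_sq (Γ.toPre (T (Γ.sec f)) ((hT (Γ.sec f)).trans_lt (Γ.energy_sec_lt f)))).trans
          ((hT (Γ.sec f)).trans (Γ.ofReal_norm_sq f).symm)
        rw [ENNReal.ofReal_eq_ofReal_iff (by positivity) (by positivity)] at h
        exact (sq_eq_sq₀ (norm_nonneg _) (norm_nonneg _)).1 h }
  { toLinearMap := (SeparationQuotient.liftCLM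
      ((SeparationQuotient.mkCLM ℂ Γ.PreL2).comp T₀.toContinuousLinearMap)
      (fun _ _ h => SeparationQuotient.mk_eq_mk.2 (h.map T₀.continuous))).toLinearMap
    norm_map' := fun f => by
      obtain ⟨f, rfl⟩ := SeparationQuotient.surjective_mk f
      exact (SeparationQuotient.norm_mk _).trans
        ((T₀.norm_map f).trans (SeparationQuotient.norm_mk _).symm) }

lemma liftIsometry_mk (T : F →ₗ[ℂ] F) (hT : ∀ f, Γ.energy (T f) = Γ.energy f) (f : Γ.PreL2) :
    Γ.liftIsometry T hT (SeparationQuotient.mk f)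
      = SeparationQuotient.mk (Γ.toPre (T (Γ.sec f)) ((hT (Γ.sec f)).trans_lt (Γ.energy_sec_lt f))) := rfl

/-- The unitary representation on `L²` induced by a linear action on sections that preserves
`∫ ‖f‖² dμ`: `g [f] = [ρ(g) f]`. -/
def unitaryRep (ρ : Representation ℂ G F) (hρ : ∀ g f, Γ.energy (ρ g f) = Γ.energy f) :
    G →* (Γ.L2 ≃ₗᵢ[ℂ] Γ.L2) where
  toFun g :=
    { toLinearEquiv := LinearEquiv.ofLinearMap (Γ.liftIsometry (ρ g) (hρ g)).toLinearMap
        (Γ.liftIsometry (ρ g⁻¹) (hρ g⁻¹)).toLinearMap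
        (by
          ext f
          obtain ⟨f, rfl⟩ := SeparationQuotient.surjective_mk f
          exact congrArg SeparationQuotient.mk (Γ.sec_injective (ρ.self_inv_apply g (Γ.sec f))))
        (by
          ext f
          obtain ⟨f, rfl⟩ := SeparationQuotient.surjective_mk f
          exact congrArg SeparationQuotient.mk (Γ.sec_injective (ρ.inv_self_apply g (Γ.sec f))))
      norm_map' := (Γ.liftIsometry (ρ g) (hρ g)).norm_map }
  map_one' := by
    ext f
    obtain ⟨f, rfl⟩ := SeparationQuotient.surjective_mk f
    exact congrArg SeparationQuotient.mk (Γ.sec_injective (by simp))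
  map_mul' g h := by
    ext f
    obtain ⟨f, rfl⟩ := SeparationQuotient.surjective_mk f
    exact congrArg SeparationQuotient.mk (Γ.sec_injective
      (LinearMap.congr_fun (map_mul ρ g h) (Γ.sec f)))

lemma unitaryRep_mk (ρ : Representation ℂ G F) (hρ : ∀ g f, Γ.energy (ρ g f) = Γ.energy f)
    (g : G) (f : Γ.PreL2) :
    Γ.unitaryRep ρ hρ g (SeparationQuotient.mk f)
      = SeparationQuotient.mk (Γ.toPre (ρ g (Γ.sec f)) ((hρ g (Γ.sec f)).trans_lt (Γ.energy_sec_lt f))) := rfl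

end SectionSpace

/-! ### Unitary representations, multiples, commutants -/

/-- The unitary representations of a group `G` on `H`. -/
abbrev UnitaryRep (G : Type*) [Group G] (H : Type*) [NormedAddCommGroup H]
    [InnerProductSpace ℂ H] := G →* (H ≃ₗᵢ[ℂ] H)

/-- The bounded operator `U(g)`. -/
def UnitaryRep.op {G : Type*} [Group G] {H : Type*} [NormedAddCommGroup H]
    [InnerProductSpace ℂ H] (U : UnitaryRep G H) (g : G) : H →L[ℂ] H :=
  (U g).toContinuousLinearEquiv.toContinuousLinearMap

/-- `U` is unitarily equivalent to a (finite or infinite) multiple of `W`, that is, to the Hilbert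
space direct sum of copies of `W` over some index set `ι`. -/
def UnitaryRep.IsMultipleOf {G : Type*} [Group G] {H K : Type*} [NormedAddCommGroup H]
    [InnerProductSpace ℂ H] [NormedAddCommGroup K] [InnerProductSpace ℂ K]
    (U : UnitaryRep G H) (W : UnitaryRep G K) : Prop :=
  ∃ (ι : Type) (V : H ≃ₗᵢ[ℂ] lp (fun _ : ι => K) 2),
    ∀ (g : G) (v : H) (i : ι), V (U g v) i = W g (V v i)

/-- The double commutant `S''` in `B(H)`. -/
def doubleCommutant {H : Type*} [NormedAddCommGroup H] [InnerProductSpace ℂ H]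
    (S : Set (H →L[ℂ] H)) : Set (H →L[ℂ] H) := Set.centralizer (Set.centralizer S)

/-! ### Direct integrals -/

/-- A measurable field of Hilbert spaces over `(X, μ)`: a linear space of vector fields, called the
measurable ones, that have measurable norm, that contains every vector field whose inner products
with measurable vector fields are measurable, and that contains a fundamental sequence. -/
structure MeasurableField {X : Type*} [MeasurableSpace X] (μ : Measure X) (E : X → Type*)
    [∀ x, NormedAddCommGroup (E x)] [∀ x, InnerProductSpace ℂ (E x)] where
  sections : Submodule ℂ (∀ x, E x)
  aemeasurable_norm : ∀ s ∈ sections, AEMeasurable (fun x => ‖s x‖) μ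
  mem_of_aemeasurable_inner : ∀ t : ∀ x, E x,
    (∀ s ∈ sections, AEMeasurable (fun x => (⟪s x, t x⟫_ℂ : ℂ)) μ) → t ∈ sections
  exists_fundamental_sequence : ∃ e : ℕ → ∀ x, E x, (∀ k, e k ∈ sections) ∧
    ∀ x, (Submodule.span ℂ (Set.range fun k => e k x)).topologicalClosure = ⊤

namespace MeasurableField

variable {X : Type*} [MeasurableSpace X] {μ : Measure X} {E : X → Type*}
  [∀ x, NormedAddCommGroup (E x)] [∀ x, InnerProductSpace ℂ (E x)]
  (𝓔 : MeasurableField μ E)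

/-- The measurable vector fields as a space of sections. -/
def sectionSpace : SectionSpace μ E 𝓔.sections where
  ev := 𝓔.sections.subtype
  aemeasurable_norm s := 𝓔.aemeasurable_norm s.1 s.2

/-- The direct integral Hilbert space `∫^⊕ E x dμ(x)`. -/
abbrev directIntegral : Type _ := 𝓔.sectionSpace.L2

instance [∀ x, CompleteSpace (E x)] : CompleteSpace 𝓔.directIntegral := by
  classical
  refine 𝓔.sectionSpace.completeSpace_L2 fun f hf => ?_
  set g : ∀ x, E x := fun x => limUnder atTop fun n => (f n).1 x with hg
  have hlim : ∀ᵐ x ∂μ, Tendsto (fun n => (f n).1 x) atTop (𝓝 (g x)) := by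
    filter_upwards [hf] with x hx
    exact hx.tendsto_limUnder
  refine ⟨⟨g, 𝓔.mem_of_aemeasurable_inner g fun s hs => ?_⟩, hlim⟩
  refine aemeasurable_of_tendsto_metrizable_ae (atTop : Filter ℕ)
    (fun n => 𝓔.sectionSpace.aemeasurable_inner ⟨s, hs⟩ (f n)) ?_
  filter_upwards [hlim] with x hx
  exact Tendsto.inner tendsto_const_nhds hx

variable {G : Type*} [Group G]

/-- A field of unitary representations is measurable if each `x ↦ U x g` is a measurable field of
operators, that is, maps measurable vector fields to measurable vector fields. -/
def IsMeasurableRep (U : ∀ x, UnitaryRep G (E x)) : Prop :=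
  ∀ g, ∀ s ∈ 𝓔.sections, (fun x => U x g (s x)) ∈ 𝓔.sections

/-- The direct integral `∫^⊕ U x dμ(x)` of a measurable field of unitary representations; it acts
by `g [s] = [x ↦ U x g (s x)]`. -/
def directIntegralRep (U : ∀ x, UnitaryRep G (E x)) (hU : 𝓔.IsMeasurableRep U) :
    UnitaryRep G 𝓔.directIntegral :=
  𝓔.sectionSpace.unitaryRep
    { toFun := fun g =>
        { toFun := fun s => ⟨fun x => U x g (s.1 x), hU g s.1 s.2⟩
          map_add' := fun s t => by ext x; simp
          map_smul' := fun c s => by ext x; simp }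
      map_one' := by ext s x; simp
      map_mul' := fun g h => by ext s x; simp }
    (fun g s => by simp [SectionSpace.energy, sectionSpace])

end MeasurableField

/-! ### Induced representations -/

section Induced

variable {G : Type*} [Group G] [MeasurableSpace G] {K : Subgroup G}

/-- The measurable functions `f : G → ℂ` with `f (g h) = σ(h)⁻¹ f(g)` for `h ∈ K`. -/
def equivariantFunctions (σ : K →* Circle) : Submodule ℂ (G → ℂ) where
  carrier := {f | Measurable f ∧ ∀ (g : G) (h : K), f (g * h) = (((σ h)⁻¹ : Circle) : ℂ) * f g}
  zero_mem' := ⟨measurable_zero, by simp⟩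
  add_mem' := by
    rintro f f' ⟨hf, hf'⟩ ⟨ht, ht'⟩
    exact ⟨hf.add ht, fun g h => by simp only [Pi.add_apply, hf', ht', mul_add]⟩
  smul_mem' := by
    rintro c f ⟨hf, hf'⟩
    exact ⟨hf.const_smul c, fun g h => by simp only [Pi.smul_apply, smul_eq_mul, hf']; ring⟩

lemma norm_equivariant_out {σ : K →* Circle} (f : equivariantFunctions σ) (g : G) :
    ‖f.1 ((QuotientGroup.mk g : G ⧸ K).out)‖ = ‖f.1 g‖ := by
  obtain ⟨h, hh⟩ := QuotientGroup.mk_out_eq_mul K g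
  rw [hh, f.2.2, norm_mul, Circle.norm_coe, one_mul]

lemma measurable_norm_out {σ : K →* Circle} (f : equivariantFunctions σ) :
    Measurable fun x : G ⧸ K => ‖f.1 x.out‖ := by
  refine QuotientGroup.measurable_from_quotient.2 ?_
  have h : (fun x : G ⧸ K => ‖f.1 x.out‖) ∘ (QuotientGroup.mk : G → G ⧸ K) = fun g => ‖f.1 g‖ :=
    funext fun g => norm_equivariant_out f g
  show Measurable ((fun x : G ⧸ K => ‖f.1 x.out‖) ∘ (QuotientGroup.mk : G → G ⧸ K))
  rw [h]
  exact f.2.1.norm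

/-- Equivariant functions as sections over `G ⧸ K`. The value at a coset is read off at a
representative; its absolute value and all inner products do not depend on the representative. -/
def inducedSections (σ : K →* Circle) (ν : Measure (G ⧸ K)) :
    SectionSpace ν (fun _ => ℂ) (equivariantFunctions σ) where
  ev :=
    { toFun := fun f x => f.1 x.out
      map_add' := fun _ _ => rfl
      map_smul' := fun _ _ => rfl }
  aemeasurable_norm f := (measurable_norm_out f).aemeasurable

/-- The Hilbert space of the induced representation: equivariant measurable functions on `G` with
`∫_{G/K} |f|² dν < ∞`, modulo functions that vanish almost everywhere. -/
abbrev InducedSpace (σ : K →* Circle) (ν : Measure (G ⧸ K)) : Type _ := (inducedSections σ ν).L2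

instance (σ : K →* Circle) (ν : Measure (G ⧸ K)) : CompleteSpace (InducedSpace σ ν) := by
  classical
  refine (inducedSections σ ν).completeSpace_L2 fun f hf => ?_
  set C : Set G := {x | ∃ c, Tendsto (fun n => (f n).1 x) atTop (𝓝 c)} with hC
  have hCm : MeasurableSet C := measurableSet_exists_tendsto fun n => (f n).2.1
  have hshift : ∀ (g : G) (h : K) (c : ℂ), Tendsto (fun n => (f n).1 g) atTop (𝓝 c) →
      Tendsto (fun n => (f n).1 (g * h)) atTop (𝓝 ((((σ h)⁻¹ : Circle) : ℂ) * c)) := by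
    intro g h c hc
    refine (hc.const_mul (((σ h)⁻¹ : Circle) : ℂ)).congr fun n => ?_
    exact ((f n).2.2 g h).symm
  have hCK : ∀ (g : G) (h : K), g * h ∈ C ↔ g ∈ C := by
    refine fun g h => ⟨fun ⟨c, hc⟩ => ?_, fun ⟨c, hc⟩ => ⟨_, hshift g h c hc⟩⟩
    have := hshift (g * h) h⁻¹ c hc
    simp only [mul_assoc, InvMemClass.coe_inv, mul_inv_cancel, mul_one] at this
    exact ⟨_, this⟩
  set F : G → ℂ := fun x => if x ∈ C then limUnder atTop (fun n => (f n).1 x) else 0 with hF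
  have hFlim : ∀ x ∈ C, Tendsto (fun n => (f n).1 x) atTop (𝓝 (F x)) := by
    intro x hx
    simp only [hF, if_pos hx]
    exact tendsto_nhds_limUnder hx
  have hFm : Measurable F := by
    refine measurable_of_tendsto_metrizable (f := fun n => C.indicator (f n).1)
      (fun n => (f n).2.1.indicator hCm) (tendsto_pi_nhds.2 fun x => ?_)
    by_cases hx : x ∈ C
    · simpa [Set.indicator_of_mem hx] using hFlim x hx
    · simp [hF, hx]
  refine ⟨⟨F, hFm, fun g h => ?_⟩, ?_⟩
  · by_cases hg : g ∈ C
    · exact tendsto_nhds_unique (hFlim _ ((hCK g h).2 hg)) (hshift g h _ (hFlim g hg))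
    · simp [hF, hg, hCK]
  · filter_upwards [hf] with x hx
    exact hFlim _ (cauchySeq_tendsto_of_complete hx)

/-- The unitary representation of `G` induced from the unitary character `σ` of the subgroup `K`,
with respect to a `G`-invariant measure `ν` on `G ⧸ K`; it acts by left translation. -/
def inducedRep [MeasurableConstSMul G G] (σ : K →* Circle) (ν : Measure (G ⧸ K))
    (hν : ∀ g : G, MeasurePreserving (fun x : G ⧸ K => g • x) ν ν) :
    UnitaryRep G (InducedSpace σ ν) :=
  (inducedSections σ ν).unitaryRep
    { toFun := fun g =>
        { toFun := fun f => ⟨fun x => f.1 (g⁻¹ * x), f.2.1.comp (measurable_const_smul g⁻¹),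
            fun x h => (congrArg f.1 (mul_assoc g⁻¹ x h).symm).trans (f.2.2 (g⁻¹ * x) h)⟩
          map_add' := fun _ _ => rfl
          map_smul' := fun _ _ => rfl }
      map_one' := by ext f x; simp
      map_mul' := fun g h => by ext f x; simp [mul_assoc] }
    (fun g f => by
      have hm : Measurable (fun x : G ⧸ K => ENNReal.ofReal (‖f.1 x.out‖ ^ 2)) :=
        ((measurable_norm_out f).pow_const 2).ennreal_ofReal
      refine Eq.trans (lintegral_congr fun x => ?_) ((hν g⁻¹).lintegral_comp hm)
      obtain ⟨y, rfl⟩ := QuotientGroup.mk_surjective x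
      have h1 : (g⁻¹ • (QuotientGroup.mk y : G ⧸ K)) = QuotientGroup.mk (g⁻¹ * y) := rfl
      obtain ⟨h, hh⟩ := QuotientGroup.mk_out_eq_mul K y
      show ENNReal.ofReal (‖f.1 (g⁻¹ * (QuotientGroup.mk y : G ⧸ K).out)‖ ^ 2)
        = ENNReal.ofReal (‖f.1 (g⁻¹ • (QuotientGroup.mk y : G ⧸ K)).out‖ ^ 2)
      rw [h1, norm_equivariant_out f, hh, ← mul_assoc, f.2.2, norm_mul, Circle.norm_coe, one_mul])

end Induced

/-! ### The Poincaré group and the subgroups attached to wedges -/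

/-- Minkowski space `ℝ^{1+3}`, with coordinates `x 0, x 1, x 2, x 3`. -/
abbrev Minkowski : Type := Fin 4 → ℝ

/-- The Minkowski product with signature `(+,-,-,-)`. -/
def minkowskiProd (p x : Minkowski) : ℝ := p 0 * x 0 - p 1 * x 1 - p 2 * x 2 - p 3 * x 3

abbrev SL2C : Type := Matrix.SpecialLinearGroup (Fin 2) ℂ

/-- The Hermitian matrix `x₀ 1 + ∑ xᵢ σᵢ`. -/
def toHerm (x : Minkowski) : Matrix (Fin 2) (Fin 2) ℂ :=
  !![(x 0 : ℂ) + x 3, x 1 - Complex.I * x 2; x 1 + Complex.I * x 2, x 0 - x 3]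

/-- The vector `x` with `toHerm x = M`, for a Hermitian matrix `M`. -/
def ofHerm (M : Matrix (Fin 2) (Fin 2) ℂ) : Minkowski :=
  ![(M 0 0 + M 1 1).re / 2, (M 1 0).re, (M 1 0).im, (M 0 0 - M 1 1).re / 2]

/-- The Lorentz transformation `Λ(A)`, with `toHerm (Λ(A) x) = A (toHerm x) A*`. -/
def lorentz (A : SL2C) (x : Minkowski) : Minkowski :=
  ofHerm (A.1 * toHerm x * A.1.conjTranspose)

lemma ofHerm_toHerm (x : Minkowski) : ofHerm (toHerm x) = x := by
  ext i
  fin_cases i <;> simp [ofHerm, toHerm]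

lemma toHerm_ofHerm {M : Matrix (Fin 2) (Fin 2) ℂ} (hM : M.IsHermitian) :
    toHerm (ofHerm M) = M := by
  have h00 := congrFun (congrFun hM 0) 0
  have h01 := congrFun (congrFun hM 0) 1
  have h11 := congrFun (congrFun hM 1) 1
  simp only [Matrix.conjTranspose_apply, Complex.ext_iff, Complex.star_def, Complex.conj_re,
    Complex.conj_im] at h00 h01 h11
  ext i j
  fin_cases i <;> fin_cases j <;> apply Complex.ext <;> simp [ofHerm, toHerm] <;> linarith

lemma isHermitian_toHerm (x : Minkowski) : (toHerm x).IsHermitian := by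
  ext i j
  fin_cases i <;> fin_cases j <;> simp [toHerm]; ring

lemma toHerm_lorentz (A : SL2C) (x : Minkowski) :
    toHerm (lorentz A x) = A.1 * toHerm x * A.1.conjTranspose :=
  toHerm_ofHerm (Matrix.isHermitian_mul_mul_conjTranspose A.1 (isHermitian_toHerm x))

lemma toHerm_injective : Function.Injective toHerm :=
  Function.LeftInverse.injective ofHerm_toHerm

lemma toHerm_add (x y : Minkowski) : toHerm (x + y) = toHerm x + toHerm y := by
  ext i j
  fin_cases i <;> fin_cases j <;> simp [toHerm] <;> ring

lemma lorentz_add (A : SL2C) (x y : Minkowski) :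
    lorentz A (x + y) = lorentz A x + lorentz A y := by
  apply toHerm_injective
  simp only [toHerm_lorentz, toHerm_add, Matrix.mul_add, Matrix.add_mul]

lemma lorentz_one (x : Minkowski) : lorentz 1 x = x := by
  apply toHerm_injective
  simp [toHerm_lorentz]

lemma lorentz_mul (A B : SL2C) (x : Minkowski) :
    lorentz (A * B) x = lorentz A (lorentz B x) := by
  apply toHerm_injective
  simp [toHerm_lorentz, Matrix.mul_assoc]

/-- The action of `SL(2,ℂ)` on the translation group by automorphisms. -/
def lorentzHom : SL2C →* MulAut (Multiplicative Minkowski) where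
  toFun A :=
    { toFun := fun x => Multiplicative.ofAdd (lorentz A x.toAdd)
      invFun := fun x => Multiplicative.ofAdd (lorentz A⁻¹ x.toAdd)
      left_inv := fun x => by simp [← lorentz_mul, lorentz_one]
      right_inv := fun x => by simp [← lorentz_mul, lorentz_one]
      map_mul' := fun x y => by simp [lorentz_add] }
  map_one' := by ext x; simp [lorentz_one]
  map_mul' A B := by ext x; simp [lorentz_mul]

/-- The universal cover `ℝ^{1+3} ⋊ SL(2,ℂ)` of the Poincaré group. -/
abbrev Poincare : Type := Multiplicative Minkowski ⋊[lorentzHom] SL2C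

/-- The product topology. -/
instance : TopologicalSpace Poincare :=
  TopologicalSpace.induced (fun g => ((g.left.toAdd, g.right) : Minkowski × SL2C)) inferInstance

instance : MeasurableSpace Poincare := borel Poincare
instance : BorelSpace Poincare := ⟨rfl⟩

/-- The action of the Poincaré group on Minkowski space. -/
def act (g : Poincare) (x : Minkowski) : Minkowski := g.left.toAdd + lorentz g.right x

/-- The wedge `W₃ = {|x₀| < x₃}`. -/
def wedge3 : Set Minkowski := {x | |x 0| < x 3}

/-- The spacelike complement `S'` (an open region). -/
def spacelikeComplement (S : Set Minkowski) : Set Minkowski :=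
  interior {x | ∀ y ∈ S, minkowskiProd (x - y) (x - y) < 0}

/-- `G₃⁰ = {A ∈ SL(2,ℂ) : Λ(A) W₃ = W₃}`. -/
def G30 : Subgroup SL2C where
  carrier := {A | lorentz A '' wedge3 = wedge3}
  one_mem' := by simp [lorentz_one]
  mul_mem' := by
    intro A B hA hB
    show lorentz (A * B) '' wedge3 = wedge3
    have h : lorentz (A * B) = lorentz A ∘ lorentz B := funext (lorentz_mul A B)
    rw [h, Set.image_comp, hB, hA]
  inv_mem' := by
    intro A hA
    show lorentz A⁻¹ '' wedge3 = wedge3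
    conv_lhs => rw [← hA]
    rw [← Set.image_comp]
    have h : lorentz A⁻¹ ∘ lorentz A = id := by
      funext x
      simp [← lorentz_mul, lorentz_one]
    rw [h, Set.image_id]

/-- `r₁(π) = exp(i (π/2) σ₁)`. -/
def r1Pi : SL2C := ⟨!![0, Complex.I; Complex.I, 0], by simp [Matrix.det_fin_two]⟩

/-- `G̃₃⁰ = ⟨G₃⁰, r₁(π)⟩`. -/
def Gt30 : Subgroup SL2C := G30 ⊔ Subgroup.zpowers r1Pi

/-- `G₃ = ℝ^{1+3} ⋊ G₃⁰`. -/
def G3 : Subgroup Poincare := G30.comap SemidirectProduct.rightHom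

/-- `G̃₃ = ℝ^{1+3} ⋊ G̃₃⁰`. -/
def Gt3 : Subgroup Poincare := Gt30.comap SemidirectProduct.rightHom

/-- The wedge `W = g W₃`; every wedge is of this form. -/
def wedge (g : Poincare) : Set Minkowski := act g '' wedge3

/-- `G_W = g G₃ g⁻¹` for `W = g W₃`. -/
def GW (g : Poincare) : Subgroup Poincare := G3.map (MulAut.conj g).toMonoidHom

/-- `G̃_W = g G̃₃ g⁻¹` for `W = g W₃`. -/
def GtW (g : Poincare) : Subgroup Poincare := Gt3.map (MulAut.conj g).toMonoidHom

/-! ### The massless representations `W_{r,n}` -/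

/-- `λ₃(t) r₃(θ) = exp((t + iθ) σ₃ / 2)`. -/
def boostRot (t θ : ℝ) : SL2C :=
  ⟨!![Complex.exp ((t + θ * Complex.I) / 2), 0; 0, Complex.exp (-((t + θ * Complex.I) / 2))], by
    rw [Matrix.det_fin_two_of, ← Complex.exp_add]
    simp⟩

lemma boostRot_val (t θ : ℝ) : (boostRot t θ).1 =
    !![Complex.exp ((t + θ * Complex.I) / 2), 0; 0, Complex.exp (-((t + θ * Complex.I) / 2))] :=
  rfl

lemma r1Pi_val : r1Pi.1 = !![0, Complex.I; Complex.I, 0] := rfl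

/-- An element of `SL(2,ℂ)` that preserves `W₃` is diagonal. -/
lemma diag_of_mem_G30 {A : SL2C} (hA : A ∈ G30) : A.1 0 1 = 0 ∧ A.1 1 0 = 0 := by
  have hdet : A.1 0 0 * A.1 1 1 - A.1 0 1 * A.1 1 0 = 1 := by
    rw [← Matrix.det_fin_two]; exact A.2
  have key : ∀ x ∈ wedge3, lorentz A x ∈ wedge3 := fun x hx => by
    have h : lorentz A '' wedge3 = wedge3 := hA
    rw [← h]
    exact Set.mem_image_of_mem _ hx
  -- the two inequalities that describe membership of the image in the wedge
  have key2 : ∀ u v : ℝ,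
      0 < Complex.normSq (A.1 0 0) - Complex.normSq (A.1 0 1)
        + 2 * (u * (A.1 0 0 * star (A.1 0 1)).re + v * (A.1 0 0 * star (A.1 0 1)).im) ∧
      0 < Complex.normSq (A.1 1 1) - Complex.normSq (A.1 1 0)
        - 2 * (u * (A.1 1 0 * star (A.1 1 1)).re + v * (A.1 1 0 * star (A.1 1 1)).im) := by
    intro u v
    have h := key ![0, u, v, 1] (by simp [wedge3])
    simp only [wedge3, Set.mem_ofPred_eq, abs_lt] at h
    simp [lorentz, ofHerm, toHerm, Matrix.mul_apply, Fin.sum_univ_two] at h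
    simp [Complex.normSq_apply]
    constructor <;> nlinarith [h.1, h.2]
  have hz : ∀ c z1 z2 : ℝ, (∀ u v : ℝ, 0 < c + 2 * (u * z1 + v * z2)) → z1 = 0 ∧ z2 = 0 := by
    intro c z1 z2 h
    constructor
    · by_contra hne
      have := h (-(c / (2 * z1))) 0
      field_simp at this
      simp at this
    · by_contra hne
      have := h 0 (-(c / (2 * z2)))
      field_simp at this
      simp at this
  have h1 := hz _ _ _ fun u v => (key2 u v).1
  have h2 := hz _ _ _ fun u v => by
    have := (key2 (-u) (-v)).2
    have e : ∀ a b z1 z2 : ℝ, a - b - 2 * (-u * z1 + -v * z2) = (a - b) + 2 * (u * z1 + v * z2) := by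
      intros; ring
    rwa [e] at this
  have p1 : A.1 0 0 * star (A.1 0 1) = 0 := Complex.ext h1.1 h1.2
  have p2 : A.1 1 0 * star (A.1 1 1) = 0 := Complex.ext h2.1 h2.2
  have pos := key2 0 0
  rcases mul_eq_zero.1 p1 with h | h
  · exfalso
    have := pos.1
    simp [h] at this
    linarith [Complex.normSq_nonneg (A.1 0 1)]
  · have h01 : A.1 0 1 = 0 := by simpa using h
    refine ⟨h01, ?_⟩
    rcases mul_eq_zero.1 p2 with h' | h'
    · exact h'
    · exfalso
      have h11 : A.1 1 1 = 0 := by simpa using h'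
      simp [h01, h11] at hdet

lemma boostRot_of_diag {A : SL2C} (h : A.1 0 1 = 0 ∧ A.1 1 0 = 0) :
    ∃ t θ : ℝ, A = boostRot t θ := by
  have hdet : A.1 0 0 * A.1 1 1 = 1 := by
    have := A.2
    rw [Matrix.det_fin_two, h.1, h.2] at this
    simpa using this
  have hne : A.1 0 0 ≠ 0 := left_ne_zero_of_mul_eq_one hdet
  set w := Complex.log (A.1 0 0) with hw
  refine ⟨2 * w.re, 2 * w.im, ?_⟩
  have he : (((2 * w.re : ℝ) : ℂ) + ((2 * w.im : ℝ) : ℂ) * Complex.I) / 2 = w := by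
    apply Complex.ext <;> simp
  have hexp : Complex.exp w = A.1 0 0 := Complex.exp_log hne
  apply Subtype.ext
  ext i j
  fin_cases i <;> fin_cases j
  · simp only [boostRot, he]; simp [hexp]
  · simp [boostRot, h.1]
  · simp [boostRot, h.2]
  · simp only [boostRot, he]
    simp [Complex.exp_neg, hexp]
    exact eq_inv_of_mul_eq_one_right hdet

lemma boostRot_mul (t θ s α : ℝ) :
    boostRot s α * boostRot t θ = boostRot (t + s) (θ + α) := by
  apply Subtype.ext
  show (boostRot s α).1 * (boostRot t θ).1 = (boostRot (t + s) (θ + α)).1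
  rw [boostRot_val, boostRot_val, boostRot_val]
  ext i j
  fin_cases i <;> fin_cases j <;>
    simp [Matrix.mul_apply, Fin.sum_univ_two, ← Complex.exp_add] <;> ring_nf

lemma boostRot_mem (t θ : ℝ) : boostRot t θ ∈ G30 := by
  have key : ∀ t θ : ℝ, ∀ x ∈ wedge3, lorentz (boostRot t θ) x ∈ wedge3 := by
    intro t θ x hx
    have hx' := abs_lt.1 (show |x 0| < x 3 from hx)
    have e1 : toHerm (lorentz (boostRot t θ) x) 0 0 = Real.exp t * (x 0 + x 3 : ℝ) := by
      rw [toHerm_lorentz]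
      simp [boostRot, toHerm, Matrix.mul_apply, Fin.sum_univ_two, ← Complex.exp_conj]
      rw [mul_right_comm, ← Complex.exp_add, show (starRingEnd ℂ) 2 = 2 from Complex.conj_ofReal 2]
      congr 2
      ring
    have e2 : toHerm (lorentz (boostRot t θ) x) 1 1 = Real.exp (-t) * (x 0 - x 3 : ℝ) := by
      rw [toHerm_lorentz]
      simp [boostRot, toHerm, Matrix.mul_apply, Fin.sum_univ_two, ← Complex.exp_conj]
      rw [mul_right_comm, ← Complex.exp_add, show (starRingEnd ℂ) 2 = 2 from Complex.conj_ofReal 2]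
      congr 2
      ring
    set y := lorentz (boostRot t θ) x
    have f1 : y 0 + y 3 = Real.exp t * (x 0 + x 3) := by
      have := e1
      simp only [toHerm, Matrix.of_apply, Matrix.cons_val', Matrix.cons_val_zero] at this
      exact_mod_cast this
    have f2 : y 0 - y 3 = Real.exp (-t) * (x 0 - x 3) := by
      have : (y 0 : ℂ) - y 3 = _ := e2
      exact_mod_cast this
    show |y 0| < y 3
    have p1 := mul_pos (Real.exp_pos t) (show 0 < x 0 + x 3 by linarith)
    have p2 := mul_pos (Real.exp_pos (-t)) (show 0 < x 3 - x 0 by linarith)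
    rw [abs_lt]
    constructor <;> nlinarith
  show lorentz (boostRot t θ) '' wedge3 = wedge3
  refine Set.Subset.antisymm (Set.image_subset_iff.2 (key t θ)) fun x hx => ?_
  refine ⟨_, key (-t) (-θ) x hx, ?_⟩
  rw [← lorentz_mul, boostRot_mul]
  have : boostRot (-t + t) (-θ + θ) = 1 := by
    apply Subtype.ext
    ext i j
    fin_cases i <;> fin_cases j <;> simp [boostRot]
  rw [this, lorentz_one]

lemma r1Pi_mul_boostRot (t θ : ℝ) : r1Pi * boostRot t θ = boostRot (-t) (-θ) * r1Pi := by
  apply Subtype.ext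
  show r1Pi.1 * (boostRot t θ).1 = (boostRot (-t) (-θ)).1 * r1Pi.1
  rw [boostRot_val, boostRot_val, r1Pi_val]
  ext i j
  fin_cases i <;> fin_cases j <;> simp [Matrix.mul_apply, Fin.sum_univ_two] <;> ring_nf

/-- Every element of `G̃₃⁰` is of the form `λ₃(t) r₃(θ)` or `λ₃(t) r₃(θ) r₁(π)`. -/
lemma exists_of_mem_Gt30 {A : SL2C} (hA : A ∈ Gt30) :
    (∃ t θ : ℝ, A = boostRot t θ) ∨ ∃ t θ : ℝ, A = boostRot t θ * r1Pi := by
  let D : Subgroup SL2C :=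
    { carrier := {A | (A.1 0 1 = 0 ∧ A.1 1 0 = 0) ∨ (A.1 0 0 = 0 ∧ A.1 1 1 = 0)}
      one_mem' := Or.inl ⟨by simp, by simp⟩
      mul_mem' := by
        intro A B hA hB
        have e : (A * B).1 = A.1 * B.1 := rfl
        simp only [Set.mem_ofPred_eq, e, Matrix.mul_apply, Fin.sum_univ_two]
        rcases hA with ⟨h1, h2⟩ | ⟨h1, h2⟩ <;> rcases hB with ⟨h3, h4⟩ | ⟨h3, h4⟩ <;>
          simp [h1, h2, h3, h4]
      inv_mem' := by
        intro A hA
        have e : (A⁻¹).1 = A.1.adjugate := rfl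
        simp only [Set.mem_ofPred_eq, e, Matrix.adjugate_fin_two]
        rcases hA with ⟨h1, h2⟩ | ⟨h1, h2⟩ <;> simp [h1, h2] }
  have hle : Gt30 ≤ D := by
    refine sup_le (fun A hA => Or.inl (diag_of_mem_G30 hA)) ?_
    rw [Subgroup.zpowers_le]
    exact Or.inr ⟨by simp [r1Pi_val], by simp [r1Pi_val]⟩
  rcases hle hA with h | h
  · exact Or.inl (boostRot_of_diag h)
  · right
    have h' : (A * r1Pi⁻¹).1 0 1 = 0 ∧ (A * r1Pi⁻¹).1 1 0 = 0 := by
      have e : (A * r1Pi⁻¹).1 = A.1 * r1Pi.1.adjugate := rfl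
      rw [e, r1Pi_val, Matrix.adjugate_fin_two]
      simp [Matrix.mul_apply, Fin.sum_univ_two, h.1, h.2]
    obtain ⟨t, θ, e⟩ := boostRot_of_diag h'
    exact ⟨t, θ, by rw [← e, inv_mul_cancel_right]⟩

lemma r1Pi_sq_mul_boostRot (t θ : ℝ) :
    boostRot t (θ + 2 * Real.pi) = boostRot t θ * r1Pi ^ 2 := by
  rw [pow_two]
  apply Subtype.ext
  show (boostRot t (θ + 2 * Real.pi)).1 = (boostRot t θ).1 * (r1Pi.1 * r1Pi.1)
  rw [boostRot_val, boostRot_val, r1Pi_val]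
  have h1 : ((t : ℂ) + ((θ + 2 * Real.pi : ℝ) : ℂ) * Complex.I) / 2
      = (t + θ * Complex.I) / 2 + Real.pi * Complex.I := by
    push_cast; ring
  rw [h1, neg_add, Complex.exp_add, Complex.exp_add, Complex.exp_neg (Real.pi * Complex.I),
    Complex.exp_pi_mul_I]
  ext i j
  fin_cases i <;> fin_cases j <;> simp [Matrix.mul_apply, Fin.sum_univ_two]

/-- The subgroup `ℝ^{1+3} ⋊ ⟨r₁(π)⟩` of `G̃₃`, the stabilizer of `q_r = (r, r, 0, 0)`. -/
def stab : Subgroup Gt3 :=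
  ((Subgroup.zpowers r1Pi).comap SemidirectProduct.rightHom).subgroupOf Gt3

/-- `q_r = (r, r, 0, 0)`. -/
def qPoint (r : ℝ) : Minkowski := ![r, r, 0, 0]

/-- The translation character `χ_p(x) = exp(i p·x)`. -/
def translationChar (p x : Minkowski) : Circle := Circle.exp (minkowskiProd p x)

lemma zpowers_r1Pi {A : SL2C} (hA : A ∈ Subgroup.zpowers r1Pi) :
    (A.1 1 1 = A.1 0 0 ∧ A.1 1 0 = A.1 0 1 ∧ ‖A.1 0 0 + A.1 0 1‖ = 1) ∧
      ∀ r x, minkowskiProd (qPoint r) (lorentz A x) = minkowskiProd (qPoint r) x := by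
  let S : Subgroup SL2C :=
    { carrier := {A | (A.1 1 1 = A.1 0 0 ∧ A.1 1 0 = A.1 0 1 ∧ ‖A.1 0 0 + A.1 0 1‖ = 1) ∧
        ∀ r x, minkowskiProd (qPoint r) (lorentz A x) = minkowskiProd (qPoint r) x}
      one_mem' := by simp [lorentz_one]
      mul_mem' := by
        rintro A B ⟨⟨a1, a2, a3⟩, a4⟩ ⟨⟨b1, b2, b3⟩, b4⟩
        have e : (A * B).1 = A.1 * B.1 := rfl
        refine ⟨⟨?_, ?_, ?_⟩, fun r x => by rw [lorentz_mul, a4, b4]⟩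
        · simp only [e, Matrix.mul_apply, Fin.sum_univ_two, a1, a2, b1, b2]; ring
        · simp only [e, Matrix.mul_apply, Fin.sum_univ_two, a1, a2, b1, b2]; ring
        · have : (A * B).1 0 0 + (A * B).1 0 1
              = (A.1 0 0 + A.1 0 1) * (B.1 0 0 + B.1 0 1) := by
            simp only [e, Matrix.mul_apply, Fin.sum_univ_two, b1, b2]; ring
          rw [this, norm_mul, a3, b3, one_mul]
      inv_mem' := by
        rintro A ⟨⟨a1, a2, a3⟩, a4⟩
        have e : (A⁻¹).1 = A.1.adjugate := rfl
        have hdet := A.2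
        rw [Matrix.det_fin_two, a1, a2] at hdet
        refine ⟨⟨?_, ?_, ?_⟩, fun r x => ?_⟩
        · simp [e, Matrix.adjugate_fin_two, a1]
        · simp [e, Matrix.adjugate_fin_two, a2]
        · have h1 : ((A⁻¹).1 0 0 + (A⁻¹).1 0 1) * (A.1 0 0 + A.1 0 1) = 1 := by
            simp only [e, Matrix.adjugate_fin_two]
            simp [a1]
            linear_combination hdet
          have h2 := congrArg norm h1
          rwa [norm_mul, a3, mul_one, norm_one] at h2
        · rw [← a4, ← lorentz_mul, mul_inv_cancel, lorentz_one] }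
  have hle : Subgroup.zpowers r1Pi ≤ S := by
    rw [Subgroup.zpowers_le]
    refine ⟨by simp [r1Pi_val], fun r x => ?_⟩
    simp [minkowskiProd, qPoint, lorentz, ofHerm, toHerm, r1Pi_val, Matrix.mul_apply,
      Fin.sum_univ_two]
  exact hle hA

/-- The first-row sum of an element of `⟨r₁(π)⟩`. As `r₁(π)` multiplies the vector `(1, 1)` by `i`,
this is `i ^ k` for `r₁(π) ^ k`, so it is the character `V₁`. -/
def rowSum (A : Subgroup.zpowers r1Pi) : Circle :=
  ⟨A.1.1 0 0 + A.1.1 0 1, mem_sphere_zero_iff_norm.2 (zpowers_r1Pi A.2).1.2.2⟩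

/-- The character `V_n` of `⟨r₁(π)⟩ ≅ ℤ/4`, with `V_n(r₁(π)) = i ^ n`. -/
def littleChar (n : Fin 4) : Subgroup.zpowers r1Pi →* Circle where
  toFun A := rowSum A ^ (n : ℕ)
  map_one' := by
    have : rowSum 1 = 1 := by
      apply Circle.ext
      show (1 : SL2C).1 0 0 + (1 : SL2C).1 0 1 = 1
      simp
    rw [this, one_pow]
  map_mul' A B := by
    have : rowSum (A * B) = rowSum A * rowSum B := by
      apply Circle.ext
      show (A.1.1 * B.1.1) 0 0 + (A.1.1 * B.1.1) 0 1
        = (A.1.1 0 0 + A.1.1 0 1) * (B.1.1 0 0 + B.1.1 0 1)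
      have h := (zpowers_r1Pi B.2).1
      simp only [Matrix.mul_apply, Fin.sum_univ_two, h.1, h.2.1]
      ring
    rw [this, mul_pow]

lemma littleChar_r1Pi (n : Fin 4) :
    (littleChar n ⟨r1Pi, Subgroup.mem_zpowers r1Pi⟩ : ℂ) = Complex.I ^ (n : ℕ) := by
  have : ((rowSum ⟨r1Pi, Subgroup.mem_zpowers r1Pi⟩ : Circle) : ℂ) = Complex.I := by
    show r1Pi.1 0 0 + r1Pi.1 0 1 = Complex.I
    simp [r1Pi_val]
  show ((rowSum _ ^ (n : ℕ) : Circle) : ℂ) = _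
  rw [Circle.coe_pow, this]

/-- The character `χ_{q_r} · V_n` of `ℝ^{1+3} ⋊ ⟨r₁(π)⟩`: `(x, A) ↦ χ_{q_r}(x) V_n(A)`. -/
def stabChar (r : ℝ) (n : Fin 4) : stab →* Circle where
  toFun h := translationChar (qPoint r) h.1.1.left.toAdd * littleChar n ⟨h.1.1.right, h.2⟩
  map_one' := by
    have : littleChar n ⟨(1 : stab).1.1.right, (1 : stab).2⟩ = 1 := (littleChar n).map_one
    rw [this]
    simp [translationChar, minkowskiProd]
  map_mul' h k := by
    have h1 : littleChar n ⟨(h * k).1.1.right, (h * k).2⟩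
        = littleChar n ⟨h.1.1.right, h.2⟩ * littleChar n ⟨k.1.1.right, k.2⟩ :=
      (littleChar n).map_mul ⟨h.1.1.right, h.2⟩ ⟨k.1.1.right, k.2⟩
    have h2 : (h * k).1.1.left.toAdd
        = h.1.1.left.toAdd + lorentz h.1.1.right k.1.1.left.toAdd := rfl
    have h3 : translationChar (qPoint r) (h * k).1.1.left.toAdd
        = translationChar (qPoint r) h.1.1.left.toAdd
          * translationChar (qPoint r) k.1.1.left.toAdd := by
      have h4 : ∀ x y, minkowskiProd (qPoint r) (x + y)
          = minkowskiProd (qPoint r) x + minkowskiProd (qPoint r) y := by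
        intro x y
        simp only [minkowskiProd, Pi.add_apply]
        ring
      rw [h2]
      unfold translationChar
      have h5 : minkowskiProd (qPoint r) (lorentz h.1.1.right k.1.1.left.toAdd)
          = minkowskiProd (qPoint r) k.1.1.left.toAdd := (zpowers_r1Pi h.2).2 _ _
      rw [h4, h5, Circle.exp_add]
    rw [h1, h3, mul_mul_mul_comm]

/-- `λ₃(t) r₃(θ)` as an element of `G̃₃`. -/
def boostRotG (t θ : ℝ) : Gt3 :=
  ⟨SemidirectProduct.inr (boostRot t θ), Subgroup.mem_sup_left (boostRot_mem t θ)⟩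

/-- The `G̃₃`-invariant measure `dt dθ` on `G̃₃ / (ℝ^{1+3} ⋊ ⟨r₁(π)⟩)`, where the coset of
`λ₃(t) r₃(θ)` has the coordinates `t ∈ ℝ` and `θ ∈ (0, 2π]`. -/
def orbitMeasure : Measure (Gt3 ⧸ stab) :=
  Measure.map (fun p : ℝ × ℝ => (QuotientGroup.mk (boostRotG p.1 p.2) : Gt3 ⧸ stab))
    ((volume : Measure ℝ).prod (volume.restrict (Set.Ioc 0 (2 * Real.pi))))

lemma continuous_lorentz (A : SL2C) : Continuous (lorentz A) := by
  refine continuous_pi fun i => ?_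
  fin_cases i <;> simp [lorentz, ofHerm, toHerm, Matrix.mul_apply, Fin.sum_univ_two] <;> fun_prop

lemma continuous_poincare_iff {Y : Type*} [TopologicalSpace Y] {f : Y → Poincare} :
    Continuous f ↔ Continuous fun y => (((f y).left.toAdd, (f y).right) : Minkowski × SL2C) :=
  continuous_induced_rng

lemma continuous_poincare_mul_left (g : Poincare) : Continuous fun x : Poincare => g * x := by
  rw [continuous_poincare_iff]
  have h := continuous_poincare_iff.1 (continuous_id (X := Poincare))
  refine Continuous.prodMk ?_ ?_
  · exact continuous_const.add ((continuous_lorentz g.right).comp h.fst)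
  · exact continuous_const.mul h.snd

instance : MeasurableConstSMul Gt3 Gt3 where
  measurable_const_smul g := by
    refine Continuous.measurable (Continuous.subtype_mk ?_ _)
    exact (continuous_poincare_mul_left g.1).comp continuous_subtype_val

lemma measurable_smul_coset (g : Gt3) : Measurable fun x : Gt3 ⧸ stab => g • x := by
  refine QuotientGroup.measurable_from_quotient.2 ?_
  exact QuotientGroup.measurable_coe.comp (measurable_const_smul g)

/-- The coset of `λ₃(t) r₃(θ)`. -/
def coset (t θ : ℝ) : Gt3 ⧸ stab := QuotientGroup.mk (boostRotG t θ)

lemma measurable_coset : Measurable fun p : ℝ × ℝ => coset p.1 p.2 := by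
  refine QuotientGroup.measurable_coe.comp (Continuous.measurable (Continuous.subtype_mk ?_ _))
  rw [continuous_poincare_iff]
  refine Continuous.prodMk continuous_const (Continuous.subtype_mk ?_ _)
  refine continuous_matrix fun i j => ?_
  fin_cases i <;> fin_cases j <;> simp <;> fun_prop

/-- Cosets in `G̃₃` depend on the homogeneous part up to right multiplication by `⟨r₁(π)⟩` only. -/
lemma mk_eq_coset (x : Gt3) (t θ : ℝ) (B : SL2C) (hB : B ∈ Subgroup.zpowers r1Pi)
    (h : x.1.right = boostRot t θ * B) : (QuotientGroup.mk x : Gt3 ⧸ stab) = coset t θ := by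
  refine (QuotientGroup.eq.2 ?_).symm
  show (boostRot t θ)⁻¹ * x.1.right ∈ Subgroup.zpowers r1Pi
  rw [h, inv_mul_cancel_left]
  exact hB

lemma coset_periodic (t : ℝ) : Function.Periodic (coset t) (2 * Real.pi) := fun θ =>
  mk_eq_coset _ _ _ (r1Pi ^ 2) (Subgroup.pow_mem _ (Subgroup.mem_zpowers _) 2)
    (r1Pi_sq_mul_boostRot t θ)

lemma smul_coset (g : Gt3) : ∃ s α : ℝ, (∀ t θ, g • coset t θ = coset (t + s) (θ + α)) ∨
    ∀ t θ, g • coset t θ = coset (-t + s) (-θ + α) := by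
  rcases exists_of_mem_Gt30 (show g.1.right ∈ Gt30 from g.2) with ⟨s, α, h⟩ | ⟨s, α, h⟩
  · refine ⟨s, α, Or.inl fun t θ => mk_eq_coset (g * boostRotG t θ) _ _ 1 (one_mem _) ?_⟩
    show g.1.right * boostRot t θ = _
    rw [h, boostRot_mul, mul_one]
  · refine ⟨s, α, Or.inr fun t θ => mk_eq_coset (g * boostRotG t θ) _ _ r1Pi
      (Subgroup.mem_zpowers _) ?_⟩
    show g.1.right * boostRot t θ = _
    rw [h, mul_assoc, r1Pi_mul_boostRot, ← mul_assoc, boostRot_mul]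

/-- Invariance of `dt dθ` under translations and reflections, for cosets that are `2π`-periodic
in `θ`. -/
lemma map_strip_eq {Y : Type*} [MeasurableSpace Y] (c : ℝ → ℝ → Y)
    (hc : Measurable fun p : ℝ × ℝ => c p.1 p.2)
    (hper : ∀ t, Function.Periodic (c t) (2 * Real.pi)) (F : Y → Y) (hF : Measurable F)
    (hFc : ∃ s α : ℝ, (∀ t θ, F (c t θ) = c (t + s) (θ + α)) ∨
      ∀ t θ, F (c t θ) = c (-t + s) (-θ + α)) :
    let ν := Measure.map (fun p : ℝ × ℝ => c p.1 p.2)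
      ((volume : Measure ℝ).prod (volume.restrict (Set.Ioc 0 (2 * Real.pi))))
    Measure.map F ν = ν := by
  intro ν
  have : Fact (0 < 2 * Real.pi) := ⟨by positivity⟩
  let q : ℝ × AddCircle (2 * Real.pi) → Y := fun p =>
    c p.1 (AddCircle.measurableEquivIoc (2 * Real.pi) 0 p.2)
  have hq : Measurable q := hc.comp
    (measurable_fst.prodMk (measurable_subtype_coe.comp
      ((AddCircle.measurableEquivIoc (2 * Real.pi) 0).measurable.comp measurable_snd)))
  have hqc : ∀ t θ : ℝ, q (t, (θ : AddCircle (2 * Real.pi))) = c t θ := by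
    intro t θ
    have h2 := AddCircle.coe_equivIoc (p := 2 * Real.pi) (a := 0) (y := (θ : AddCircle (2 * Real.pi)))
    have h3 := congrArg (hper t).lift h2
    rw [Function.Periodic.lift_coe, Function.Periodic.lift_coe] at h3
    exact h3
  have hmk := (MeasurePreserving.id (volume : Measure ℝ)).prod
    (AddCircle.measurePreserving_mk (2 * Real.pi) 0)
  rw [zero_add] at hmk
  have hν : ν = ((volume : Measure ℝ).prod (volume : Measure (AddCircle (2 * Real.pi)))).map q := by
    rw [← hmk.map_eq, Measure.map_map hq hmk.measurable]
    have e : (fun p : ℝ × ℝ => c p.1 p.2)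
        = q ∘ Prod.map id ((↑) : ℝ → AddCircle (2 * Real.pi)) :=
      funext fun p => (hqc p.1 p.2).symm
    rw [← e]
  obtain ⟨s, α, h | h⟩ := hFc
  · have hT := (measurePreserving_add_right (volume : Measure ℝ) s).prod
      (measurePreserving_add_right (volume : Measure (AddCircle (2 * Real.pi)))
        (α : AddCircle (2 * Real.pi)))
    have e : F ∘ q = q ∘ Prod.map (fun t => t + s) (fun x => x + (α : AddCircle (2 * Real.pi))) := by
      funext ⟨t, x⟩
      obtain ⟨θ, rfl⟩ := QuotientAddGroup.mk_surjective x
      exact (congrArg F (hqc t θ)).trans ((h t θ).trans (hqc (t + s) (θ + α)).symm)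
    rw [hν, Measure.map_map hF hq, e, ← Measure.map_map hq hT.measurable, hT.map_eq]
  · have hT := ((measurePreserving_add_right (volume : Measure ℝ) s).comp
        (Measure.measurePreserving_neg volume)).prod
      ((measurePreserving_add_right (volume : Measure (AddCircle (2 * Real.pi)))
        (α : AddCircle (2 * Real.pi))).comp (Measure.measurePreserving_neg volume))
    have e : F ∘ q = q ∘ Prod.map ((fun t => t + s) ∘ Neg.neg)
        ((fun x => x + (α : AddCircle (2 * Real.pi))) ∘ Neg.neg) := by
      funext ⟨t, x⟩
      obtain ⟨θ, rfl⟩ := QuotientAddGroup.mk_surjective x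
      exact (congrArg F (hqc t θ)).trans ((h t θ).trans (hqc (-t + s) (-θ + α)).symm)
    rw [hν, Measure.map_map hF hq, e, ← Measure.map_map hq hT.measurable, hT.map_eq]

lemma measurePreserving_orbitMeasure (g : Gt3) :
    MeasurePreserving (fun x : Gt3 ⧸ stab => g • x) orbitMeasure orbitMeasure :=
  ⟨measurable_smul_coset g, map_strip_eq coset measurable_coset coset_periodic _
    (measurable_smul_coset g) (smul_coset g)⟩

/-- The massless representation `W_{r,n} = Ind_{ℝ^{1+3} ⋊ ⟨r₁(π)⟩}^{G̃₃} (χ_{q_r} · V_n)`. -/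
def masslessRep (r : ℝ) (n : Fin 4) :
    UnitaryRep Gt3 (InducedSpace (stabChar r n) orbitMeasure) :=
  inducedRep (stabChar r n) orbitMeasure measurePreserving_orbitMeasure

/-- The massless representation `W_{r,n}` of `G̃_W = g G̃₃ g⁻¹`, for the wedge `W = g W₃`. -/
def masslessRepW (g : Poincare) (r : ℝ) (n : Fin 4) :
    UnitaryRep (GtW g) (InducedSpace (stabChar r n) orbitMeasure) :=
  (masslessRep r n).comp ((MulAut.conj g).subgroupMap Gt3).symm.toMonoidHom

/-! ### Every wedge is mapped to its spacelike complement by an element of `G̃_W` -/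

lemma act_mul (g h : Poincare) (x : Minkowski) : act (g * h) x = act g (act h x) := by
  show (g.left.toAdd + lorentz g.right h.left.toAdd) + lorentz (g.right * h.right) x
    = g.left.toAdd + lorentz g.right (h.left.toAdd + lorentz h.right x)
  rw [lorentz_add, lorentz_mul, add_assoc]

lemma act_one (x : Minkowski) : act 1 x = x := by
  show (0 : Minkowski) + lorentz 1 x = x
  rw [lorentz_one, zero_add]

lemma minkowskiProd_self_lorentz (A : SL2C) (x : Minkowski) :
    minkowskiProd (lorentz A x) (lorentz A x) = minkowskiProd x x := by
  have h : ∀ y : Minkowski, ((minkowskiProd y y : ℝ) : ℂ) = (toHerm y).det := by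
    intro y
    rw [toHerm, Matrix.det_fin_two_of, minkowskiProd]
    push_cast
    linear_combination (-(y 2 : ℂ) ^ 2) * Complex.I_sq
  have h2 : (toHerm (lorentz A x)).det = (toHerm x).det := by
    rw [toHerm_lorentz, Matrix.det_mul, Matrix.det_mul, Matrix.det_conjTranspose, A.2]
    simp
  exact_mod_cast (h _).trans (h2.trans (h x).symm)

/-- The action of a Poincaré transformation as a homeomorphism. -/
def actHomeo (g : Poincare) : Minkowski ≃ₜ Minkowski where
  toFun := act g
  invFun := act g⁻¹
  left_inv x := by rw [← act_mul, inv_mul_cancel, act_one]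
  right_inv x := by rw [← act_mul, mul_inv_cancel, act_one]
  continuous_toFun := continuous_const.add (continuous_lorentz g.right)
  continuous_invFun := continuous_const.add (continuous_lorentz g⁻¹.right)

lemma spacelikeComplement_act (g : Poincare) (S : Set Minkowski) :
    spacelikeComplement (act g '' S) = act g '' spacelikeComplement S := by
  have h := (actHomeo g).image_interior {x | ∀ y ∈ S, minkowskiProd (x - y) (x - y) < 0}
  show _ = actHomeo g '' interior _
  rw [h]
  unfold spacelikeComplement
  congr 1
  have hinv : ∀ x y, minkowskiProd (act g x - act g y) (act g x - act g y)
      = minkowskiProd (x - y) (x - y) := by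
    intro x y
    have e : act g x - act g y = lorentz g.right (x - y) := by
      have := lorentz_add g.right (x - y) y
      rw [sub_add_cancel] at this
      rw [act, act, this]
      abel
    rw [e, minkowskiProd_self_lorentz]
  ext z
  constructor
  · intro hz
    refine ⟨(actHomeo g).symm z, fun y hy => ?_, (actHomeo g).apply_symm_apply z⟩
    have h1 := hz (act g y) (Set.mem_image_of_mem _ hy)
    rw [← hinv]
    have h2 : act g ((actHomeo g).symm z) = z := (actHomeo g).apply_symm_apply z
    rwa [h2]
  · rintro ⟨x, hx, rfl⟩ _ ⟨y, hy, rfl⟩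
    have := hx y hy
    rw [← hinv] at this
    exact this

lemma spacelikeComplement_wedge3 : spacelikeComplement wedge3 = {x | |x 0| < -x 3} := by
  have hcl : {x : Minkowski | ∀ y ∈ wedge3, minkowskiProd (x - y) (x - y) < 0}
      = {x | |x 0| ≤ -x 3} := by
    ext x
    simp only [Set.mem_ofPred_eq]
    constructor
    · intro h
      -- otherwise some point of the wedge is not spacelike to `x`
      have key : ∀ u v : ℝ, 0 < u → v < 0 → ¬ 0 ≤ (x 0 + x 3 - u) * (x 0 - x 3 - v) := by
        intro u v hu hv hle
        have h1 := h ![(u + v) / 2, x 1, x 2, (u - v) / 2] (by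
          simp only [wedge3, Set.mem_ofPred_eq, abs_lt]
          simp
          constructor <;> linarith)
        simp [minkowskiProd] at h1
        nlinarith
      rw [abs_le]
      constructor
      · by_contra hx
        exact key (x 3 - x 0 + |x 0 + x 3| + |x 0 - x 3| + 1) ((x 0 - x 3) / 2)
          (by linarith [abs_nonneg (x 0 + x 3), neg_abs_le (x 0 - x 3), le_abs_self (x 0 - x 3)])
          (by linarith) (mul_nonneg_of_nonpos_of_nonpos
            (by linarith [le_abs_self (x 0 + x 3), abs_nonneg (x 0 - x 3)]) (by linarith))
      · by_contra hx
        exact key ((x 0 + x 3) / 2) (-(|x 0 - x 3| + 1)) (by linarith)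
          (by linarith [abs_nonneg (x 0 - x 3)])
          (mul_nonneg (by linarith) (by linarith [neg_abs_le (x 0 - x 3)]))
    · intro h y hy
      have hy' := abs_lt.1 (show |y 0| < y 3 from hy)
      have hx' := abs_le.1 h
      simp only [minkowskiProd, Pi.sub_apply]
      nlinarith [mul_pos (show 0 < -(x 3 - y 3) + (x 0 - y 0) by linarith)
        (show 0 < -(x 3 - y 3) - (x 0 - y 0) by linarith), mul_self_nonneg (x 1 - y 1),
        mul_self_nonneg (x 2 - y 2)]
  rw [spacelikeComplement, hcl]
  refine Set.Subset.antisymm (fun x hx => ?_) ?_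
  · have hcont : Tendsto (fun ε : ℝ => x + ε • (Pi.single 3 1 : Minkowski)) (𝓝[>] 0) (𝓝 x) := by
      refine tendsto_nhdsWithin_of_tendsto_nhds ?_
      have : Continuous fun ε : ℝ => x + ε • (Pi.single 3 1 : Minkowski) := by fun_prop
      simpa using this.tendsto 0
    have hev := hcont.eventually (mem_interior_iff_mem_nhds.1 hx)
    obtain ⟨ε, h1, h2⟩ := (hev.and self_mem_nhdsWithin).exists
    have h1' : |(x + ε • (Pi.single 3 1 : Minkowski)) 0|
      ≤ -(x + ε • (Pi.single 3 1 : Minkowski)) 3 := h1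
    simp at h1'
    have h2' : 0 < ε := h2
    show |x 0| < -x 3
    linarith
  · refine interior_maximal (fun x (hx : |x 0| < -x 3) => show |x 0| ≤ -x 3 from hx.le) ?_
    exact isOpen_lt (by fun_prop) (by fun_prop)

lemma act_r1Pi_wedge3 : act (SemidirectProduct.inr r1Pi) '' wedge3 = spacelikeComplement wedge3 := by
  have h : ∀ x, act (SemidirectProduct.inr r1Pi) x = ![x 0, x 1, -x 2, -x 3] := by
    intro x
    show (0 : Minkowski) + lorentz r1Pi x = _
    rw [zero_add]
    ext i
    fin_cases i <;> simp [lorentz, ofHerm, toHerm, r1Pi_val, Matrix.mul_apply, Fin.sum_univ_two]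
    ring
  rw [spacelikeComplement_wedge3]
  ext z
  constructor
  · rintro ⟨x, hx, rfl⟩
    rw [h]
    simpa [wedge3] using hx
  · intro hz
    refine ⟨![z 0, z 1, -z 2, -z 3], by simpa [wedge3] using hz, ?_⟩
    rw [h]
    ext i
    fin_cases i <;> simp

/-- There are elements `r_W ∈ G̃_W` with `r_W W = W'`. -/
lemma exists_flip (g : Poincare) :
    ∃ w : GtW g, act w '' wedge g = spacelikeComplement (wedge g) := by
  refine ⟨⟨g * SemidirectProduct.inr r1Pi * g⁻¹, SemidirectProduct.inr r1Pi, ?_, rfl⟩, ?_⟩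
  · exact Subgroup.mem_sup_right (Subgroup.mem_zpowers r1Pi)
  · rw [wedge, spacelikeComplement_act, ← act_r1Pi_wedge3, ← Set.image_comp, ← Set.image_comp]
    refine Set.image_congr fun x _ => ?_
    show act (g * SemidirectProduct.inr r1Pi * g⁻¹) (act g x) = _
    rw [← act_mul, inv_mul_cancel_right, act_mul]
    rfl

/-! ### The modularity condition -/

/-- The modularity condition, for the wedge `W = g W₃`, of a representation `U` of `G̃_W`:
`U(r_W) ∈ U(G_W)''` for the elements `r_W` with `r_W W = W'`. -/
def ModularityCondition (g : Poincare) {H : Type*} [NormedAddCommGroup H] [InnerProductSpace ℂ H]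
    (U : UnitaryRep (GtW g) H) : Prop :=
  ∀ w : GtW g, act w '' wedge g = spacelikeComplement (wedge g) →
    U.op w ∈ doubleCommutant {T | ∃ h : GtW g, (h : Poincare) ∈ GW g ∧ U.op h = T}

end MasslessMC

end

/-!
Let `T` commute with the operators of `G_W`; it has to be shown that `T` commutes with `U(r_W)`.

* Already the restriction of `W_{r,n}` to `G₃` is irreducible. Its elements are functions on the
  orbit of `q_r`, on which translations by `a` act as multiplication by `exp(i p · a)` and the
  boost-rotations act transitively by translation. For an operator commuting with both, the
  matrix coefficients on the one hand and the translation invariance on the other force it to be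
  multiplication by a constant.
* An average of `U` over four spatial translations of length `1/k`, raised to the power `k² m`,
  converges on multiples of `W_{r,n}` to the scalar `exp(-m r²/4)`, as in the central limit theorem.
  So `T` commutes with multiplication by polynomials in `exp(-r²/4)`, an injective function of `r`,
  and therefore acts fibrewise.
* In almost every fibre, `T` has the commutation relations with a countable subgroup of `G₃` that
  still acts irreducibly in `W_{r,n}`, and by the first point also that with `r_W`.
-/

noncomputable section

namespace MasslessMC

/-! ### Uniqueness of Fourier transforms and of moments -/

section Fourier

variable {X : Type*} [MeasurableSpace X] {ν : Measure X}
  {V : Type*} [NormedAddCommGroup V] [InnerProductSpace ℝ V] [SecondCountableTopology V]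
  [MeasurableSpace V] [BorelSpace V] {p : X → V}

lemma integrable_exp_inner_mul (hp : Measurable p) {F : X → ℂ} (hF : Integrable F ν) (a : V) :
    Integrable (fun x => Complex.exp (⟪p x, a⟫_ℝ * Complex.I) * F x) ν :=
  hF.bdd_mul (c := 1) (Measurable.aestronglyMeasurable (by fun_prop))
    (Eventually.of_forall fun x => (Complex.norm_exp_ofReal_mul_I _).le)

lemma charFun_map_withDensity (hp : Measurable p) {f : X → ℝ} (hf : AEMeasurable f ν)
    (hf0 : ∀ x, 0 ≤ f x) (a : V) :
    charFun ((ν.withDensity fun x => ENNReal.ofReal (f x)).map p) a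
      = ∫ x, Complex.exp (⟪p x, a⟫_ℝ * Complex.I) * f x ∂ν := by
  rw [charFun_apply, integral_map hp.aemeasurable (by fun_prop),
    integral_withDensity_eq_integral_toReal_smul₀ hf.ennreal_ofReal (by simp)]
  refine integral_congr_ae (Eventually.of_forall fun x => ?_)
  simp [ENNReal.toReal_ofReal (hf0 x), mul_comm]

lemma integral_exp_inner_mul_re_eq_zero (hp : Measurable p) {F : X → ℂ} (hF : Integrable F ν)
    (h : ∀ a : V, ∫ x, Complex.exp (⟪p x, a⟫_ℝ * Complex.I) * F x ∂ν = 0) (a : V) :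
    ∫ x, Complex.exp (⟪p x, a⟫_ℝ * Complex.I) * (F x).re ∂ν = 0 := by
  have hFconj : Integrable (fun x => (starRingEnd ℂ) (F x)) ν :=
    Complex.conjCLE.toContinuousLinearMap.integrable_comp hF
  have hconj : ∫ x, Complex.exp (⟪p x, a⟫_ℝ * Complex.I) * (starRingEnd ℂ) (F x) ∂ν = 0 := by
    calc _ = ∫ x, (starRingEnd ℂ) (Complex.exp (⟪p x, -a⟫_ℝ * Complex.I) * F x) ∂ν := by
          simp [← Complex.exp_conj]
      _ = 0 := by rw [integral_conj, h, map_zero]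
  calc _ = ∫ x, (Complex.exp (⟪p x, a⟫_ℝ * Complex.I) * F x
        + Complex.exp (⟪p x, a⟫_ℝ * Complex.I) * (starRingEnd ℂ) (F x)) / 2 ∂ν := by
        refine integral_congr_ae (Eventually.of_forall fun x => ?_)
        simp only [Complex.re_eq_add_conj]
        ring
    _ = 0 := by
        rw [integral_div, integral_add (integrable_exp_inner_mul hp hF a)
          (integrable_exp_inner_mul hp hFconj a), h, hconj, add_zero, zero_div]

variable [CompleteSpace V]

lemma setIntegral_preimage_eq_zero_of_integral_exp_inner_real (hp : Measurable p) {f : X → ℝ}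
    (hf : Integrable f ν)
    (h : ∀ a : V, ∫ x, Complex.exp (⟪p x, a⟫_ℝ * Complex.I) * f x ∂ν = 0)
    {D : Set V} (hD : MeasurableSet D) : ∫ x in p ⁻¹' D, f x ∂ν = 0 := by
  have hmax (y : ℝ) : ENNReal.ofReal (max y 0) = ENNReal.ofReal y := by
    simp [ENNReal.ofReal_max]
  have hexp (a : V) {k : X → ℝ} (hk : Integrable k ν) :
      Integrable (fun x => Complex.exp (⟪p x, a⟫_ℝ * Complex.I) * (k x : ℂ)) ν :=
    integrable_exp_inner_mul hp hk.ofReal a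
  have := isFiniteMeasure_withDensity_ofReal hf.pos_part.2
  have := isFiniteMeasure_withDensity_ofReal hf.neg_part.2
  have hmap : (ν.withDensity fun x => ENNReal.ofReal (max (f x) 0)).map p
      = (ν.withDensity fun x => ENNReal.ofReal (max (-f x) 0)).map p := by
    refine Measure.ext_of_charFun (funext fun a => ?_)
    rw [charFun_map_withDensity hp hf.pos_part.aemeasurable fun x => le_max_right _ _,
      charFun_map_withDensity hp hf.neg_part.aemeasurable fun x => le_max_right _ _, ← sub_eq_zero,
      ← integral_sub (hexp a hf.pos_part) (hexp a hf.neg_part), ← h a]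
    refine integral_congr_ae (Eventually.of_forall fun x => ?_)
    simp only [← mul_sub, ← Complex.ofReal_sub, max_zero_sub_eq_self]
  have hmass := congrArg (fun m => m D) hmap
  simp only [Measure.map_apply hp hD, withDensity_apply _ (hp hD), hmax] at hmass
  rw [integral_eq_lintegral_pos_part_sub_lintegral_neg_part hf.integrableOn, hmass, sub_self]

lemma setIntegral_preimage_eq_zero_of_integral_exp_inner (hp : Measurable p) {F : X → ℂ}
    (hF : Integrable F ν)
    (h : ∀ a : V, ∫ x, Complex.exp (⟪p x, a⟫_ℝ * Complex.I) * F x ∂ν = 0)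
    {D : Set V} (hD : MeasurableSet D) : ∫ x in p ⁻¹' D, F x ∂ν = 0 := by
  have hre := setIntegral_preimage_eq_zero_of_integral_exp_inner_real hp hF.re
    (integral_exp_inner_mul_re_eq_zero hp hF h) hD
  have hI (a : V) : ∫ x, Complex.exp (⟪p x, a⟫_ℝ * Complex.I) * (-Complex.I * F x) ∂ν = 0 := by
    simp_rw [mul_left_comm _ (-Complex.I), integral_const_mul, h, mul_zero]
  have him := setIntegral_preimage_eq_zero_of_integral_exp_inner_real hp
    (hF.const_mul (-Complex.I)).re
    (integral_exp_inner_mul_re_eq_zero hp (hF.const_mul (-Complex.I)) hI) hD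
  rw [← integral_re_add_im (𝕜 := ℂ) hF.integrableOn, hre]
  simpa using him

variable [StandardBorelSpace X]

lemma ae_eq_zero_of_integral_exp_inner (hp : Measurable p) {A : Set X} (hA : MeasurableSet A)
    (hνA : ∀ᵐ x ∂ν, x ∈ A) (hinj : Set.InjOn p A) {F : X → ℂ} (hF : Integrable F ν)
    (h : ∀ a : V, ∫ x, Complex.exp (⟪p x, a⟫_ℝ * Complex.I) * F x ∂ν = 0) : F =ᵐ[ν] 0 := by
  refine hF.ae_eq_zero_of_forall_setIntegral_eq_zero fun B hB _ => ?_
  have hD : MeasurableSet (p '' (B ∩ A)) :=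
    (hB.inter hA).image_of_measurable_injOn hp (hinj.mono Set.inter_subset_right)
  have hae : (p ⁻¹' (p '' (B ∩ A)) : Set X) =ᵐ[ν] B := by
    filter_upwards [hνA] with x hx
    refine propext ⟨?_, fun hxB => ⟨x, ⟨hxB, hx⟩, rfl⟩⟩
    rintro ⟨y, ⟨hy, hyA⟩, hxy⟩
    rwa [← hinj hyA hx hxy]
  rw [← setIntegral_congr_set hae,
    setIntegral_preimage_eq_zero_of_integral_exp_inner hp hF h hD]

lemma ae_eq_zero_of_integral_exp_inner_dense (hp : Measurable p) {A : Set X}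
    (hA : MeasurableSet A) (hνA : ∀ᵐ x ∂ν, x ∈ A) (hinj : Set.InjOn p A) {F : X → ℂ}
    (hF : Integrable F ν) {D : Set V} (hD : Dense D)
    (h : ∀ a ∈ D, ∫ x, Complex.exp (⟪p x, a⟫_ℝ * Complex.I) * F x ∂ν = 0) : F =ᵐ[ν] 0 := by
  have hcont : Continuous fun a : V => ∫ x, Complex.exp (⟪p x, a⟫_ℝ * Complex.I) * F x ∂ν := by
    refine continuous_of_dominated (bound := fun x => ‖F x‖)
      (fun a => (integrable_exp_inner_mul hp hF a).1) (fun a => ?_) hF.norm ?_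
    · exact Eventually.of_forall fun x => by simp [Complex.norm_exp_ofReal_mul_I]
    · exact Eventually.of_forall fun x => by fun_prop
  exact ae_eq_zero_of_integral_exp_inner hp hA hνA hinj hF
    (congrFun (Continuous.ext_on hD hcont continuous_const h))

lemma hasSum_integral_pow_mul {X : Type*} [MeasurableSpace X] {ν : Measure X} {u : X → ℝ}
    (hu : Measurable u) {C : ℝ} (hC : ∀ x, |u x| ≤ C) {F : X → ℂ} (hF : Integrable F ν) (a : ℝ) :
    HasSum (fun m : ℕ => (a * Complex.I) ^ m / m.factorial * ∫ x, (u x : ℂ) ^ m * F x ∂ν)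
      (∫ x, Complex.exp (⟪u x, a⟫_ℝ * Complex.I) * F x ∂ν) := by
  simp_rw [← integral_const_mul]
  refine hasSum_integral_of_dominated_convergence
    (fun m x => (|a| * C) ^ m / m.factorial * ‖F x‖) (fun m => ?_) (fun m => ?_) ?_ ?_ ?_
  · exact ((Measurable.aestronglyMeasurable (by fun_prop)).mul hF.1).const_mul _
  · refine Eventually.of_forall fun x => ?_
    calc _ = (|a| * |u x|) ^ m / m.factorial * ‖F x‖ := by
          simp only [norm_mul, norm_div, norm_pow, Complex.norm_I, Complex.norm_real,
            Complex.norm_natCast, Real.norm_eq_abs, mul_pow]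
          ring
      _ ≤ _ := by
          gcongr
          exact hC x
  · exact Eventually.of_forall fun x => (Real.summable_pow_div_factorial _).mul_right _
  · simp_rw [tsum_mul_right]
    exact hF.norm.const_mul _
  · refine Eventually.of_forall fun x => ?_
    have hexp := (NormedSpace.expSeries_div_hasSum_exp (⟪u x, a⟫_ℝ * Complex.I)).mul_right (F x)
    rw [← Complex.exp_eq_exp_ℂ] at hexp
    refine hexp.congr_fun fun m => ?_
    have hinner : ((⟪u x, a⟫_ℝ : ℝ) : ℂ) = a * u x := by simp
    rw [hinner, mul_pow, mul_pow, mul_pow]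
    ring

lemma ae_eq_zero_of_integral_pow {u : X → ℝ} (hu : Measurable u) (hinj : Function.Injective u)
    {C : ℝ} (hC : ∀ x, |u x| ≤ C) {F : X → ℂ} (hF : Integrable F ν)
    (h : ∀ m : ℕ, ∫ x, (u x : ℂ) ^ m * F x ∂ν = 0) : F =ᵐ[ν] 0 := by
  refine ae_eq_zero_of_integral_exp_inner hu MeasurableSet.univ (by simp) hinj.injOn hF fun a => ?_
  have hsum := hasSum_integral_pow_mul hu hC hF a
  simp only [h, mul_zero] at hsum
  exact hsum.unique hasSum_zero

end Fourier

lemma ae_ae_of_forall_ae_sub {Z : Type*} [MeasurableSpace Z] [AddCommGroup Z] [MeasurableAdd₂ Z]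
    [MeasurableNeg Z] {ν : Measure Z} [SFinite ν] {lam : Measure Z} [SFinite lam]
    [lam.IsAddRightInvariant] {P : Z → Z → Prop}
    (hP : MeasurableSet {q : Z × Z | P q.1 q.2}) (h : ∀ s, ∀ᵐ z ∂ν, P z (z - s)) :
    ∀ᵐ z ∂ν, ∀ᵐ u ∂lam, P z u := by
  have hmeas : MeasurableSet {q : Z × Z | P q.2 (q.2 - q.1)} :=
    hP.preimage (f := fun q : Z × Z => (q.2, q.2 - q.1)) (by fun_prop)
  have hswap := (Measure.ae_ae_comm (μ := lam) (p := fun s z => P z (z - s)) hmeas).1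
    (Eventually.of_forall h)
  filter_upwards [hswap] with z hz
  have hquasi := (quasiMeasurePreserving_sub_left_of_right_invariant lam z).ae hz
  filter_upwards [hquasi] with u hu
  rwa [sub_sub_cancel] at hu

/-! ### Continuity of translations in `L²` of a strip -/

section Translation

lemma tendsto_eLpNorm_sub_translate {Z E : Type*} [TopologicalSpace Z] [AddGroup Z]
    [IsTopologicalAddGroup Z] [MeasurableSpace Z] [BorelSpace Z]
    {ν : Measure Z} [ν.IsAddRightInvariant] [ν.InnerRegularCompactLTTop] [IsLocallyFiniteMeasure ν]
    [NormedAddCommGroup E] {p : ℝ≥0∞} [Fact (1 ≤ p)] (hp : p ≠ ∞) {F : Z → E} (hF : MemLp F p ν) :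
    Tendsto (fun s => eLpNorm (fun z => F (z - s) - F z) p ν) (𝓝 0) (𝓝 0) := by
  let τ : Z → C(Z, Z) := fun s => ⟨fun z => z - s, by fun_prop⟩
  have hτ : Continuous τ :=
    ContinuousMap.continuous_of_continuous_uncurry _ (continuous_snd.sub continuous_fst)
  have hmp (s : Z) : MeasurePreserving (τ s) ν ν := measurePreserving_sub_right ν s
  have htranslate (s : Z) :
      Lp.compMeasurePreserving (τ s) (hmp s) (hF.toLp F)
        = (hF.comp_measurePreserving (hmp s)).toLp _ :=
    Lp.toLp_compMeasurePreserving hF (hmp s)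
  have hzero : (hF.comp_measurePreserving (hmp 0)).toLp _ = hF.toLp F :=
    MemLp.toLp_congr _ _ (Eventually.of_forall fun z => by simp [τ])
  have hcont := (((continuous_const (y := hF.toLp F)).compMeasurePreservingLp hτ hmp
    hp).tendsto 0).sub_const (hF.toLp F)
  simp only [htranslate, hzero, sub_self, ← MemLp.toLp_sub] at hcont
  have henorm := hcont.enorm
  simp only [Lp.enorm_toLp, enorm_zero] at henorm
  exact henorm

lemma setLIntegral_Ioc_add_eq_of_periodic {f : ℝ → ℝ≥0∞} {T : ℝ} (hf : Function.Periodic f T)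
    (hT : 0 < T) (a b : ℝ) : ∫⁻ x in Set.Ioc a (a + T), f x = ∫⁻ x in Set.Ioc b (b + T), f x := by
  refine (isAddFundamentalDomain_Ioc hT a).setLIntegral_eq (isAddFundamentalDomain_Ioc hT b) f ?_
  rintro ⟨_, m, rfl⟩ x
  simpa [AddSubgroup.vadd_def, add_comm] using hf.zsmul m x

/-- The measure `dt dθ` on the strip of all `(t, θ)` with `θ ∈ (0, 2π]`. -/
def stripMeasure : Measure (ℝ × ℝ) :=
  (volume : Measure ℝ).prod (volume.restrict (Set.Ioc 0 (2 * Real.pi)))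

instance : SFinite stripMeasure := by
  unfold stripMeasure
  infer_instance

lemma stripMeasure_eq_restrict :
    stripMeasure = volume.restrict (Set.univ ×ˢ Set.Ioc (0 : ℝ) (2 * Real.pi)) := by
  rw [stripMeasure, Measure.volume_eq_prod, ← Measure.prod_restrict, Measure.restrict_univ]

lemma setLIntegral_two_periods_eq_two_mul {k : ℝ × ℝ → ℝ≥0∞} (hk : Measurable k)
    (hper : ∀ t, Function.Periodic (fun θ => k (t, θ)) (2 * Real.pi)) :
    ∫⁻ z in Set.univ ×ˢ Set.Ioc (-Real.pi) (3 * Real.pi), k z = 2 * ∫⁻ z, k z ∂stripMeasure := by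
  have hpi := Real.two_pi_pos
  have hsplit : Set.Ioc (-Real.pi) (3 * Real.pi)
      = Set.Ioc (-Real.pi) (-Real.pi + 2 * Real.pi) ∪ Set.Ioc Real.pi (Real.pi + 2 * Real.pi) := by
    rw [show -Real.pi + 2 * Real.pi = Real.pi by ring,
      show Real.pi + 2 * Real.pi = 3 * Real.pi by ring, Set.Ioc_union_Ioc_eq_Ioc] <;> linarith
  rw [stripMeasure, Measure.volume_eq_prod, ← Measure.prod_restrict, Measure.restrict_univ,
    lintegral_prod _ hk.aemeasurable, lintegral_prod _ hk.aemeasurable,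
    ← lintegral_const_mul _ hk.lintegral_prod_right']
  refine lintegral_congr fun t => ?_
  rw [hsplit, lintegral_union measurableSet_Ioc,
    setLIntegral_Ioc_add_eq_of_periodic (hper t) hpi (-Real.pi) 0,
    setLIntegral_Ioc_add_eq_of_periodic (hper t) hpi Real.pi 0, zero_add, two_mul (lintegral _ _)]
  exact Set.Ioc_disjoint_Ioc_of_le (by linarith)

lemma tendsto_eLpNorm_strip_translate {F : ℝ × ℝ → ℂ} (hF : Measurable F)
    (hper : ∀ t, Function.Periodic (fun θ => ‖F (t, θ)‖) (2 * Real.pi))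
    (hL2 : eLpNorm F 2 stripMeasure < ∞) :
    Tendsto (fun s => eLpNorm (fun z => F (z - s) - F z) 2 stripMeasure) (𝓝 0) (𝓝 0) := by
  -- A translation by less than `π` in `θ` maps the strip into two periods around it.
  let S : Set (ℝ × ℝ) := Set.univ ×ˢ Set.Ioc (-Real.pi) (3 * Real.pi)
  have hS : MeasurableSet S := MeasurableSet.univ.prod measurableSet_Ioc
  have hG : MemLp (S.indicator F) 2 volume := by
    refine (memLp_indicator_iff_restrict hS).2 ⟨hF.aestronglyMeasurable, ?_⟩
    rw [eLpNorm_lt_top_iff_lintegral_rpow_enorm_lt_top two_ne_zero ENNReal.ofNat_ne_top] at hL2 ⊢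
    rw [setLIntegral_two_periods_eq_two_mul (by fun_prop) fun t θ => by
      simp only [← ofReal_norm, hper t θ]]
    exact ENNReal.mul_lt_top ENNReal.ofNat_lt_top hL2
  refine tendsto_of_tendsto_of_tendsto_of_le_of_le' tendsto_const_nhds
    (tendsto_eLpNorm_sub_translate ENNReal.ofNat_ne_top hG)
    (Eventually.of_forall fun _ => zero_le) ?_
  filter_upwards [Metric.ball_mem_nhds (0 : ℝ × ℝ) Real.pi_pos] with s hs
  have hs2 : |s.2| < Real.pi := (norm_snd_le s).trans_lt (by simpa using hs)
  have hle : eLpNorm (fun z => F (z - s) - F z) 2 stripMeasure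
      = eLpNorm (fun z => S.indicator F (z - s) - S.indicator F z) 2 stripMeasure := by
    refine eLpNorm_congr_ae ?_
    rw [stripMeasure_eq_restrict]
    filter_upwards [ae_restrict_mem (MeasurableSet.univ.prod measurableSet_Ioc)] with z hz
    rw [abs_lt] at hs2
    obtain ⟨-, hz0, hz1⟩ := hz
    have hzS : z ∈ S := ⟨trivial, by constructor <;> linarith⟩
    have hzsS : z - s ∈ S := ⟨trivial, by constructor <;> rw [Prod.snd_sub] <;> linarith⟩
    rw [Set.indicator_of_mem hzS, Set.indicator_of_mem hzsS]
  rw [hle, stripMeasure_eq_restrict]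
  exact eLpNorm_restrict_le _ _ _ _

end Translation

/-! ### The orbit of `q_r` under boosts and rotations -/

section Orbit

/-- The translation by `a` as an element of `G̃₃`. -/
def transG (a : Minkowski) : Gt3 :=
  ⟨SemidirectProduct.inl (Multiplicative.ofAdd a), one_mem Gt30⟩

lemma boostRotG_inv_mul (s z : ℝ × ℝ) :
    (boostRotG s.1 s.2)⁻¹ * boostRotG z.1 z.2 = boostRotG (z - s).1 (z - s).2 := by
  rw [inv_mul_eq_iff_eq_mul]
  refine Subtype.ext ?_
  change SemidirectProduct.inr (boostRot z.1 z.2)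
    = SemidirectProduct.inr (boostRot s.1 s.2)
      * SemidirectProduct.inr (boostRot (z - s).1 (z - s).2)
  rw [← map_mul, boostRot_mul, ← Prod.fst_add, ← Prod.snd_add, sub_add_cancel]

lemma boostRot_inv (t θ : ℝ) : (boostRot t θ)⁻¹ = boostRot (-t) (-θ) := by
  rw [inv_eq_iff_mul_eq_one, boostRot_mul]
  apply Subtype.ext
  ext i j
  fin_cases i <;> fin_cases j <;> simp [boostRot]

lemma boostRot_mul_mul_conjTranspose (t θ : ℝ) (M : Matrix (Fin 2) (Fin 2) ℂ) :
    (boostRot t θ).1 * M * (boostRot t θ).1.conjTranspose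
      = !![Real.exp t * M 0 0, Complex.exp (θ * Complex.I) * M 0 1;
          Complex.exp (-(θ * Complex.I)) * M 1 0, Real.exp (-t) * M 1 1] := by
  have htwo : (starRingEnd ℂ) 2 = 2 := Complex.conj_ofReal 2
  ext i j
  fin_cases i <;> fin_cases j <;>
    simp only [boostRot_val, Matrix.mul_apply, Fin.sum_univ_two, Matrix.conjTranspose_apply,
      Fin.zero_eta, Fin.mk_one, Matrix.of_apply, Matrix.cons_val', Matrix.cons_val_zero,
      Matrix.cons_val_one, Matrix.cons_val_fin_one, map_zero, zero_mul, mul_zero, add_zero,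
      zero_add, RCLike.star_def, ← Complex.exp_conj, map_div₀, map_neg, map_add, map_mul,
      Complex.conj_ofReal, Complex.conj_I, htwo, Complex.ofReal_exp, Complex.ofReal_neg] <;>
    rw [mul_right_comm, ← Complex.exp_add] <;>
    ring_nf

lemma lorentz_boostRot (t θ : ℝ) (a : Minkowski) :
    lorentz (boostRot t θ) a
      = ![Real.cosh t * a 0 + Real.sinh t * a 3, Real.cos θ * a 1 + Real.sin θ * a 2,
          Real.cos θ * a 2 - Real.sin θ * a 1, Real.sinh t * a 0 + Real.cosh t * a 3] := by
  rw [lorentz, boostRot_mul_mul_conjTranspose]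
  ext i
  fin_cases i <;>
    simp [ofHerm, toHerm, Complex.exp_re, Complex.exp_im, Real.cosh_eq, Real.sinh_eq] <;>
    ring

/-- The point `Λ(λ₃(t) r₃(θ)) q_r` of the orbit of `q_r`, identified through the Minkowski product
with a vector of Euclidean `ℝ⁴`. -/
def momentum (r : ℝ) (z : ℝ × ℝ) : EuclideanSpace ℝ (Fin 4) :=
  !₂[r * Real.cosh z.1, -(r * Real.cos z.2), r * Real.sin z.2, -(r * Real.sinh z.1)]

lemma inner_momentum (r : ℝ) (z : ℝ × ℝ) (a : Minkowski) :
    ⟪momentum r z, WithLp.toLp 2 a⟫_ℝ = r * (Real.cosh z.1 * a 0 - Real.cos z.2 * a 1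
      + Real.sin z.2 * a 2 - Real.sinh z.1 * a 3) := by
  simp only [momentum, PiLp.inner_apply, Fin.sum_univ_four, RCLike.inner_apply, conj_trivial,
    Matrix.cons_val]
  ring

lemma measurable_momentum (r : ℝ) : Measurable (momentum r) := by
  refine ((PiLp.continuous_toLp 2 _).comp (continuous_pi fun i => ?_)).measurable
  fin_cases i <;> simp only [Fin.reduceFinMk, Fin.zero_eta, Fin.mk_one, Matrix.cons_val] <;>
    fun_prop

lemma injOn_momentum {r : ℝ} (hr : r ≠ 0) :
    Set.InjOn (momentum r) (Set.univ ×ˢ Set.Ioc (0 : ℝ) (2 * Real.pi)) := by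
  rintro ⟨t, θ⟩ ⟨-, hθ⟩ ⟨t', θ'⟩ ⟨-, hθ'⟩ h
  have hcoord (i : Fin 4) : momentum r (t, θ) i = momentum r (t', θ') i := by rw [h]
  have hcos : Real.cos θ = Real.cos θ' := by simpa [momentum, hr] using hcoord 1
  have hsin : Real.sin θ = Real.sin θ' := by simpa [momentum, hr] using hcoord 2
  have hsinh : t = t' := by simpa [momentum, hr] using hcoord 3
  have : Fact (0 < 2 * Real.pi) := ⟨Real.two_pi_pos⟩
  rw [← zero_add (2 * Real.pi)] at hθ hθ'
  exact Prod.ext hsinh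
    ((AddCircle.coe_eq_coe_iff_of_mem_Ioc hθ hθ').1 (Real.Angle.cos_sin_inj hcos hsin))

lemma minkowskiProd_qPoint_lorentz_inv (r t θ : ℝ) (a : Minkowski) :
    minkowskiProd (qPoint r) (lorentz (boostRot t θ)⁻¹ a)
      = ⟪momentum r (t, θ), WithLp.toLp 2 a⟫_ℝ := by
  rw [boostRot_inv, lorentz_boostRot, inner_momentum]
  simp only [minkowskiProd, qPoint, Matrix.cons_val, Real.cosh_neg, Real.sinh_neg, Real.cos_neg,
    Real.sin_neg]
  ring

lemma exists_transG_inv_mul_boostRotG (r : ℝ) (n : Fin 4) (a : Minkowski) (t θ : ℝ) :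
    ∃ h : stab, (transG a)⁻¹ * boostRotG t θ = boostRotG t θ * h ∧
      (((stabChar r n h)⁻¹ : Circle) : ℂ)
        = Complex.exp (⟪momentum r (t, θ), WithLp.toLp 2 a⟫_ℝ * Complex.I) := by
  let b := lorentz (boostRot t θ)⁻¹ (-a)
  refine ⟨⟨transG b, one_mem (Subgroup.zpowers r1Pi)⟩, ?_, ?_⟩
  · rw [inv_mul_eq_iff_eq_mul]
    refine Subtype.ext (SemidirectProduct.ext ?_ ?_)
    · change (1 : Multiplicative Minkowski) = Multiplicative.ofAdd
        (a + lorentz 1 (0 + lorentz (boostRot t θ) (lorentz (boostRot t θ)⁻¹ (-a))))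
      rw [lorentz_one, ← lorentz_mul, mul_inv_cancel, lorentz_one, zero_add, add_neg_cancel]
      rfl
    · change boostRot t θ = 1 * (boostRot t θ * 1)
      rw [one_mul, mul_one]
  · have hchar : stabChar r n ⟨transG b, one_mem (Subgroup.zpowers r1Pi)⟩
        = translationChar (qPoint r) b := by
      change translationChar (qPoint r) b * littleChar n 1 = _
      rw [map_one, mul_one]
    rw [hchar, translationChar, minkowskiProd_qPoint_lorentz_inv, ← Circle.exp_neg, Circle.coe_exp]
    simp

end Orbit

/-! ### Vectors of `W_{r,n}` as functions on the strip -/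

section Coordinates

variable {r : ℝ} {n : Fin 4}

variable (r n) in
/-- The equivariant functions on which `W_{r,n}` acts, as sections over the orbit. -/
abbrev masslessSections :
    SectionSpace orbitMeasure (fun _ => ℂ) (equivariantFunctions (stabChar r n)) :=
  inducedSections (stabChar r n) orbitMeasure

/-- A square-integrable equivariant function, read at `λ₃(t) r₃(θ)` as a function of `(t, θ)`. -/
def stripFun (f : (masslessSections r n).PreL2) (z : ℝ × ℝ) : ℂ :=
  ((masslessSections r n).sec f).1 (boostRotG z.1 z.2)

lemma measurable_boostRotG : Measurable fun z : ℝ × ℝ => boostRotG z.1 z.2 := by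
  refine Continuous.measurable (Continuous.subtype_mk ?_ _)
  rw [continuous_poincare_iff]
  refine Continuous.prodMk continuous_const (Continuous.subtype_mk ?_ _)
  refine continuous_matrix fun i j => ?_
  fin_cases i <;> fin_cases j <;>
    simp only [Fin.zero_eta, Fin.mk_one, Matrix.of_apply, Matrix.cons_val',
      Matrix.cons_val_zero, Matrix.cons_val_one, Matrix.cons_val_fin_one] <;>
    fun_prop

lemma measurable_stripFun (f : (masslessSections r n).PreL2) : Measurable (stripFun f) :=
  ((masslessSections r n).sec f).2.1.comp measurable_boostRotG

lemma stripFun_sub (f g : (masslessSections r n).PreL2) (z : ℝ × ℝ) :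
    stripFun (f - g) z = stripFun f z - stripFun g z := rfl

lemma stripFun_smul (c : ℂ) (f : (masslessSections r n).PreL2) (z : ℝ × ℝ) :
    stripFun (c • f) z = c * stripFun f z := rfl

lemma periodic_norm_stripFun (f : (masslessSections r n).PreL2) (t : ℝ) :
    Function.Periodic (fun θ => ‖stripFun f (t, θ)‖) (2 * Real.pi) := fun θ =>
  (norm_equivariant_out _ _).symm.trans <|
    (congrArg (fun x : Gt3 ⧸ stab => ‖((masslessSections r n).sec f).1 x.out‖)
      (coset_periodic t θ)).trans (norm_equivariant_out _ _)

lemma enorm_eq_eLpNorm_stripFun (f : (masslessSections r n).PreL2) :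
    ‖f‖ₑ = eLpNorm (stripFun f) 2 stripMeasure := by
  have henergy : (masslessSections r n).energy ((masslessSections r n).sec f)
      = ∫⁻ z, ‖stripFun f z‖ₑ ^ 2 ∂stripMeasure := by
    refine (lintegral_map ((measurable_norm_out _).pow_const 2).ennreal_ofReal
      measurable_coset).trans (lintegral_congr fun z => ?_)
    rw [coset, norm_equivariant_out, ENNReal.ofReal_pow (norm_nonneg _), ofReal_norm]
    rfl
  have hsq := (masslessSections r n).ofReal_norm_sq f
  rw [henergy, ENNReal.ofReal_pow (norm_nonneg _), ofReal_norm] at hsq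
  refine (ENNReal.pow_right_strictMono two_ne_zero).injective (hsq.trans ?_)
  simpa using (eLpNorm_nnreal_pow_eq_lintegral (f := stripFun f) (μ := stripMeasure)
    (p := 2) two_ne_zero).symm

lemma memLp_stripFun (f : (masslessSections r n).PreL2) : MemLp (stripFun f) 2 stripMeasure :=
  ⟨(measurable_stripFun f).aestronglyMeasurable, enorm_eq_eLpNorm_stripFun f ▸ enorm_lt_top⟩

lemma mk_eq_zero_iff {f : (masslessSections r n).PreL2} :
    (SeparationQuotient.mk f : InducedSpace (stabChar r n) orbitMeasure) = 0 ↔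
      stripFun f =ᵐ[stripMeasure] 0 := by
  rw [← enorm_eq_zero, ← ofReal_norm, SeparationQuotient.norm_mk, ofReal_norm,
    enorm_eq_eLpNorm_stripFun,
    eLpNorm_eq_zero_iff (measurable_stripFun f).aestronglyMeasurable two_ne_zero]

lemma mk_eq_mk_iff {f g : (masslessSections r n).PreL2} :
    (SeparationQuotient.mk f : InducedSpace (stabChar r n) orbitMeasure) = SeparationQuotient.mk g ↔
      stripFun f =ᵐ[stripMeasure] stripFun g := by
  rw [← sub_eq_zero, ← SeparationQuotient.mk_sub, mk_eq_zero_iff]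
  simp only [EventuallyEq, stripFun_sub, Pi.zero_apply, sub_eq_zero]

lemma exists_ev_coset_eq_mul (z : ℝ × ℝ) : ∃ c : Circle, ∀ f : (masslessSections r n).PreL2,
    (masslessSections r n).ev ((masslessSections r n).sec f) (coset z.1 z.2)
      = (c : ℂ) * stripFun f z := by
  obtain ⟨h, hh⟩ := QuotientGroup.mk_out_eq_mul stab (boostRotG z.1 z.2)
  refine ⟨(stabChar r n h)⁻¹, fun k => ?_⟩
  change ((masslessSections r n).sec k).1 (coset z.1 z.2).out = _
  rw [coset, hh, ((masslessSections r n).sec k).2.2]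
  rfl

lemma inner_eq_integral_stripFun (f g : (masslessSections r n).PreL2) :
    ⟪f, g⟫_ℂ = ∫ z, (starRingEnd ℂ) (stripFun f z) * stripFun g z ∂stripMeasure := by
  have hmeas := ((masslessSections r n).aemeasurable_inner ((masslessSections r n).sec f)
    ((masslessSections r n).sec g)).aestronglyMeasurable
  refine ((masslessSections r n).inner_def f g).trans
    ((integral_map measurable_coset.aemeasurable hmeas).trans (integral_congr_ae <|
      Eventually.of_forall fun z => ?_))
  obtain ⟨c, hc⟩ := exists_ev_coset_eq_mul (r := r) (n := n) z
  have hphase : (starRingEnd ℂ) (c : ℂ) * (c : ℂ) = 1 := by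
    rw [← Circle.coe_inv_eq_conj, ← Circle.coe_mul, inv_mul_cancel, Circle.coe_one]
  simp only [hc, RCLike.inner_apply, map_mul]
  linear_combination ((starRingEnd ℂ) (stripFun f z) * stripFun g z) * hphase

lemma integrable_conj_stripFun_mul (f g : (masslessSections r n).PreL2) :
    Integrable (fun z => (starRingEnd ℂ) (stripFun f z) * stripFun g z) stripMeasure :=
  (memLp_stripFun f).star.integrable_mul (memLp_stripFun g)

lemma exists_masslessRep_mk (g : Gt3) (f : (masslessSections r n).PreL2) :
    ∃ f' : (masslessSections r n).PreL2,
      masslessRep r n g (SeparationQuotient.mk f) = SeparationQuotient.mk f' ∧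
      ∀ z, stripFun f' z = ((masslessSections r n).sec f).1 (g⁻¹ * boostRotG z.1 z.2) :=
  ⟨_, rfl, fun _ => rfl⟩

lemma exists_masslessRep_boostRotG (s : ℝ × ℝ) (f : (masslessSections r n).PreL2) :
    ∃ f' : (masslessSections r n).PreL2,
      masslessRep r n (boostRotG s.1 s.2) (SeparationQuotient.mk f) = SeparationQuotient.mk f' ∧
      ∀ z, stripFun f' z = stripFun f (z - s) := by
  obtain ⟨f', hmk, hf'⟩ := exists_masslessRep_mk (boostRotG s.1 s.2) f
  exact ⟨f', hmk, fun z => by rw [hf', boostRotG_inv_mul, stripFun]⟩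

lemma exists_masslessRep_transG (a : Minkowski) (f : (masslessSections r n).PreL2) :
    ∃ f' : (masslessSections r n).PreL2,
      masslessRep r n (transG a) (SeparationQuotient.mk f) = SeparationQuotient.mk f' ∧
      ∀ z, stripFun f' z
        = Complex.exp (⟪momentum r z, WithLp.toLp 2 a⟫_ℝ * Complex.I) * stripFun f z := by
  obtain ⟨f', hmk, hf'⟩ := exists_masslessRep_mk (transG a) f
  refine ⟨f', hmk, fun z => ?_⟩
  obtain ⟨h, hcomm, hchar⟩ := exists_transG_inv_mul_boostRotG r n a z.1 z.2
  rw [hf', hcomm, ((masslessSections r n).sec f).2.2, hchar, stripFun]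

end Coordinates

/-! ### Irreducibility of `W_{r,n}` -/

section Irreducible

variable {r : ℝ} {n : Fin 4}

lemma exists_eq_smul_one_of_frequently {H Z : Type*} [NormedAddCommGroup H] [NormedSpace ℂ H]
    (S : H →L[ℂ] H) {y : H} (hy : y ≠ 0) {l : Filter Z} {α β : Z → ℂ} (hα : ∃ᶠ z in l, α z ≠ 0)
    (h : ∀ x, ∀ᶠ z in l, α z • S x = β z • x) : ∃ c : ℂ, S = c • 1 := by
  have hdiv (z) (hz : α z ≠ 0) (x) (hx : α z • S x = β z • x) : S x = ((α z)⁻¹ * β z) • x := by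
    rw [mul_smul, ← hx, inv_smul_smul₀ hz]
  obtain ⟨z₀, hz₀, hy₀⟩ := (hα.and_eventually (h y)).exists
  refine ⟨(α z₀)⁻¹ * β z₀, ContinuousLinearMap.ext fun x => ?_⟩
  obtain ⟨z, hz, hxz, hyz⟩ := (hα.and_eventually ((h x).and (h y))).exists
  have hratio : (α z₀)⁻¹ * β z₀ = (α z)⁻¹ * β z :=
    smul_left_injective ℂ hy ((hdiv z₀ hz₀ y hy₀).symm.trans (hdiv z hz y hyz))
  rw [hdiv z hz x hxz, hratio]
  rfl

lemma boostRotG_add (s u : ℝ × ℝ) :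
    boostRotG (s + u).1 (s + u).2 = boostRotG s.1 s.2 * boostRotG u.1 u.2 := by
  rw [← inv_mul_eq_iff_eq_mul, boostRotG_inv_mul, add_sub_cancel_left]

lemma edist_masslessRep_boostRotG (s : ℝ × ℝ) (f : (masslessSections r n).PreL2) :
    edist (masslessRep r n (boostRotG s.1 s.2) (SeparationQuotient.mk f)) (SeparationQuotient.mk f)
      = eLpNorm (fun z => stripFun f (z - s) - stripFun f z) 2 stripMeasure := by
  obtain ⟨f', hmk, hf'⟩ := exists_masslessRep_boostRotG s f
  rw [hmk, SeparationQuotient.edist_mk, edist_eq_enorm_sub, enorm_eq_eLpNorm_stripFun]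
  simp only [← hf', ← stripFun_sub]

lemma continuous_masslessRep_boostRotG (x : InducedSpace (stabChar r n) orbitMeasure) :
    Continuous fun s : ℝ × ℝ => masslessRep r n (boostRotG s.1 s.2) x := by
  obtain ⟨f, rfl⟩ := SeparationQuotient.surjective_mk x
  have hzero : Tendsto (fun s : ℝ × ℝ => edist (masslessRep r n (boostRotG s.1 s.2)
      (SeparationQuotient.mk f)) (SeparationQuotient.mk f)) (𝓝 0) (𝓝 0) := by
    simp only [edist_masslessRep_boostRotG]
    exact tendsto_eLpNorm_strip_translate (measurable_stripFun f) (periodic_norm_stripFun f)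
      (memLp_stripFun f).2
  refine continuous_iff_continuousAt.2 fun s₀ => tendsto_iff_edist_tendsto_0.2 ?_
  have hsub : Tendsto (fun s : ℝ × ℝ => s - s₀) (𝓝 s₀) (𝓝 0) :=
    tendsto_sub_nhds_zero_iff.2 tendsto_id
  refine (hzero.comp hsub).congr fun s => ?_
  have hmul : boostRotG s.1 s.2 = boostRotG s₀.1 s₀.2 * boostRotG (s - s₀).1 (s - s₀).2 := by
    rw [← boostRotG_add, add_sub_cancel]
  rw [hmul, map_mul, LinearIsometryEquiv.coe_mul, Function.comp_apply, Function.comp_apply,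
    LinearIsometryEquiv.edist_map]

lemma dense_range_toLp_ratCast (ι : Type*) :
    Dense (Set.range fun q : ι → ℚ => (WithLp.toLp 2 fun i => (q i : ℝ) : EuclideanSpace ℝ ι)) :=
  (WithLp.toLp_surjective 2).denseRange.comp (DenseRange.piMap fun _ => Rat.denseRange_cast)
    (PiLp.continuous_toLp 2 _)

/-- An operator commuting with the translations acts pointwise: the functions
`z ↦ conj (y z) * f z`, whose Fourier coefficients over the orbit are the matrix coefficients of
the translations, match on both sides. -/
lemma ae_conj_mul_eq_of_commute_transG (hr : r ≠ 0)
    {S : InducedSpace (stabChar r n) orbitMeasure →L[ℂ] InducedSpace (stabChar r n) orbitMeasure}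
    (hT : ∀ q : Fin 4 → ℚ, Commute S ((masslessRep r n).op (transG fun i => q i)))
    {y y' f f' : (masslessSections r n).PreL2}
    (hy : ContinuousLinearMap.adjoint S (SeparationQuotient.mk y) = SeparationQuotient.mk y')
    (hf : S (SeparationQuotient.mk f) = SeparationQuotient.mk f') :
    ∀ᵐ z ∂stripMeasure,
      (starRingEnd ℂ) (stripFun y' z) * stripFun f z
        = (starRingEnd ℂ) (stripFun y z) * stripFun f' z := by
  have hstrip : MeasurableSet (Set.univ ×ˢ Set.Ioc (0 : ℝ) (2 * Real.pi) : Set (ℝ × ℝ)) :=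
    MeasurableSet.univ.prod measurableSet_Ioc
  have hzero := ae_eq_zero_of_integral_exp_inner_dense (measurable_momentum r) hstrip
    (stripMeasure_eq_restrict ▸ ae_restrict_mem hstrip) (injOn_momentum hr)
    ((integrable_conj_stripFun_mul y' f).sub (integrable_conj_stripFun_mul y f'))
    (dense_range_toLp_ratCast (Fin 4)) ?_
  · exact hzero.mono fun z hz => sub_eq_zero.1 hz
  rintro _ ⟨q, rfl⟩
  obtain ⟨k, hk, hkf⟩ := exists_masslessRep_transG (fun i => (q i : ℝ)) f
  obtain ⟨k', hk', hkf'⟩ := exists_masslessRep_transG (fun i => (q i : ℝ)) f'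
  have hSk : S (SeparationQuotient.mk k) = SeparationQuotient.mk k' := by
    rw [← hk, ← hk', ← hf]
    exact congr($(hT q) (SeparationQuotient.mk f))
  have hinner : ⟪y', k⟫_ℂ = ⟪y, k'⟫_ℂ :=
    (SeparationQuotient.inner_mk_mk y' k).symm.trans <| Eq.trans
      (by rw [← hy, ContinuousLinearMap.adjoint_inner_left, hSk])
      (SeparationQuotient.inner_mk_mk y k')
  rw [inner_eq_integral_stripFun, inner_eq_integral_stripFun, ← sub_eq_zero, ← integral_sub
    (integrable_conj_stripFun_mul y' k) (integrable_conj_stripFun_mul y k')] at hinner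
  rw [← hinner]
  refine integral_congr_ae (Eventually.of_forall fun z => ?_)
  simp only [Pi.sub_apply, hkf, hkf']
  ring

/-- Boosts and rotations translate the strip, so commuting with them as well decouples the
argument of `y` from that of `x`. -/
lemma ae_conj_smul_eq_of_commute (hr : r ≠ 0)
    {S : InducedSpace (stabChar r n) orbitMeasure →L[ℂ] InducedSpace (stabChar r n) orbitMeasure}
    (hT : ∀ q : Fin 4 → ℚ, Commute S ((masslessRep r n).op (transG fun i => q i)))
    (hB : ∀ s : ℝ × ℝ, Commute S ((masslessRep r n).op (boostRotG s.1 s.2)))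
    {y y' : (masslessSections r n).PreL2}
    (hy : ContinuousLinearMap.adjoint S (SeparationQuotient.mk y) = SeparationQuotient.mk y')
    (x : InducedSpace (stabChar r n) orbitMeasure) :
    ∀ᵐ z ∂stripMeasure,
      (starRingEnd ℂ) (stripFun y z) • S x = (starRingEnd ℂ) (stripFun y' z) • x := by
  obtain ⟨f, rfl⟩ := SeparationQuotient.surjective_mk x
  obtain ⟨f', hf'⟩ := SeparationQuotient.surjective_mk (S (SeparationQuotient.mk f))
  have htranslate (s : ℝ × ℝ) : ∀ᵐ z ∂stripMeasure,
      (starRingEnd ℂ) (stripFun y' z) * stripFun f (z - s)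
        = (starRingEnd ℂ) (stripFun y z) * stripFun f' (z - s) := by
    obtain ⟨k, hk, hkf⟩ := exists_masslessRep_boostRotG s f
    obtain ⟨k', hk', hkf'⟩ := exists_masslessRep_boostRotG s f'
    have hSk : S (SeparationQuotient.mk k) = SeparationQuotient.mk k' := by
      rw [← hk, ← hk', hf']
      exact congr($(hB s) (SeparationQuotient.mk f))
    simpa only [hkf, hkf'] using ae_conj_mul_eq_of_commute_transG hr hT hy hSk
  let P (z u : ℝ × ℝ) : Prop := (starRingEnd ℂ) (stripFun y' z) * stripFun f u
    = (starRingEnd ℂ) (stripFun y z) * stripFun f' u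
  have hmeas : MeasurableSet {q : (ℝ × ℝ) × (ℝ × ℝ) | P q.1 q.2} := by
    have hconj : Measurable (starRingEnd ℂ) := Complex.continuous_conj.measurable
    have h (k : (masslessSections r n).PreL2) := measurable_stripFun k
    exact measurableSet_eq_fun
      ((hconj.comp ((h y').comp measurable_fst)).mul ((h f).comp measurable_snd))
      ((hconj.comp ((h y).comp measurable_fst)).mul ((h f').comp measurable_snd))
  filter_upwards [ae_ae_of_forall_ae_sub (lam := volume) (P := P) hmeas htranslate] with z hz
  rw [← hf', ← SeparationQuotient.mk_smul, ← SeparationQuotient.mk_smul, mk_eq_mk_iff,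
    stripMeasure_eq_restrict]
  filter_upwards [ae_restrict_of_ae hz] with u hu
  rw [stripFun_smul, stripFun_smul, hu]

lemma commute_boostRotG_of_forall_rat
    {S : InducedSpace (stabChar r n) orbitMeasure →L[ℂ] InducedSpace (stabChar r n) orbitMeasure}
    (hB : ∀ s : ℚ × ℚ, Commute S ((masslessRep r n).op (boostRotG s.1 s.2))) (s : ℝ × ℝ) :
    Commute S ((masslessRep r n).op (boostRotG s.1 s.2)) := by
  refine ContinuousLinearMap.ext fun x => ?_
  have hdense : DenseRange fun q : ℚ × ℚ => ((q.1 : ℝ), (q.2 : ℝ)) :=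
    Rat.denseRange_cast.prodMap Rat.denseRange_cast
  exact congrFun (hdense.equalizer (S.continuous.comp (continuous_masslessRep_boostRotG x))
    (continuous_masslessRep_boostRotG (S x)) (funext fun q => congr($(hB q) x))) s

lemma exists_eq_smul_one_of_commute_of_ne_zero (hr : r ≠ 0)
    {S : InducedSpace (stabChar r n) orbitMeasure →L[ℂ] InducedSpace (stabChar r n) orbitMeasure}
    (hT : ∀ q : Fin 4 → ℚ, Commute S ((masslessRep r n).op (transG fun i => q i)))
    (hB : ∀ s : ℝ × ℝ, Commute S ((masslessRep r n).op (boostRotG s.1 s.2)))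
    {y : (masslessSections r n).PreL2}
    (hy : (SeparationQuotient.mk y : InducedSpace (stabChar r n) orbitMeasure) ≠ 0) :
    ∃ c : ℂ, S = c • 1 := by
  obtain ⟨y', hy'⟩ := SeparationQuotient.surjective_mk
    (ContinuousLinearMap.adjoint S (SeparationQuotient.mk y))
  have hfreq : ∃ᵐ z ∂stripMeasure, (starRingEnd ℂ) (stripFun y z) ≠ 0 := fun h =>
    hy <| mk_eq_zero_iff.2 <| h.mono fun z hz => (map_eq_zero _).1 (not_not.1 hz)
  exact exists_eq_smul_one_of_frequently S hy hfreq
    (ae_conj_smul_eq_of_commute hr hT hB hy'.symm)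

lemma exists_eq_smul_one_of_commute (hr : r ≠ 0)
    {S : InducedSpace (stabChar r n) orbitMeasure →L[ℂ] InducedSpace (stabChar r n) orbitMeasure}
    (hT : ∀ q : Fin 4 → ℚ, Commute S ((masslessRep r n).op (transG fun i => q i)))
    (hB : ∀ s : ℚ × ℚ, Commute S ((masslessRep r n).op (boostRotG s.1 s.2))) :
    ∃ c : ℂ, S = c • 1 := by
  by_contra hS
  have hzero (x : InducedSpace (stabChar r n) orbitMeasure) : x = 0 := by
    obtain ⟨y, rfl⟩ := SeparationQuotient.surjective_mk x
    exact not_ne_iff.1 fun hy => hS <| exists_eq_smul_one_of_commute_of_ne_zero hr hT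
      (commute_boostRotG_of_forall_rat hB) hy
  exact hS ⟨0, ContinuousLinearMap.ext fun x => (hzero _).trans (hzero _).symm⟩

end Irreducible

/-! ### Double commutants and multiples of a representation -/

section DoubleCommutant

variable {G : Type*} [Group G] {H K : Type*} [NormedAddCommGroup H] [InnerProductSpace ℂ H]
  [NormedAddCommGroup K] [InnerProductSpace ℂ K]

lemma UnitaryRep.op_mem_doubleCommutant_iff {U : UnitaryRep G H} {S : Set G} {w : G} :
    U.op w ∈ doubleCommutant (U.op '' S) ↔
      ∀ T : H →L[ℂ] H, (∀ h ∈ S, Commute T (U.op h)) → Commute T (U.op w) := by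
  simp only [doubleCommutant, Set.mem_centralizer_iff, Set.forall_mem_image, commute_iff_eq,
    eq_comm (a := _ * U.op _)]

lemma UnitaryRep.inner_apply_right (U : UnitaryRep G H) (g : G) (x y : H) :
    ⟪x, U g y⟫_ℂ = ⟪U g⁻¹ x, y⟫_ℂ := by
  have h : U g (U g⁻¹ x) = x := by
    change (U g * U g⁻¹) x = x
    rw [← map_mul, mul_inv_cancel, map_one, LinearIsometryEquiv.coe_one, id]
  rw [← (U g).inner_map_map (U g⁻¹ x), h]

lemma UnitaryRep.IsMultipleOf.exists_intertwiners {U : UnitaryRep G H} {W : UnitaryRep G K}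
    (hU : U.IsMultipleOf W) :
    ∃ (ι : Type) (incl : ι → K →L[ℂ] H) (comp : ι → H →L[ℂ] K),
      (∀ g i, incl i ∘L W.op g = U.op g ∘L incl i) ∧
      (∀ g i, comp i ∘L U.op g = W.op g ∘L comp i) ∧
      ∀ A B : H →L[ℂ] H, (∀ i j, comp j ∘L A ∘L incl i = comp j ∘L B ∘L incl i) → A = B := by
  classical
  obtain ⟨ι, V, hV⟩ := hU
  let V' : lp (fun _ : ι => K) 2 →L[ℂ] H := V.symm.toContinuousLinearEquiv.toContinuousLinearMap
  refine ⟨ι, fun i => V' ∘L lp.singleContinuousLinearMap ℂ (fun _ : ι => K) 2 i,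
    fun i => lp.evalCLM ℂ (fun _ : ι => K) 2 i ∘L V.toContinuousLinearEquiv.toContinuousLinearMap,
    fun g i => ContinuousLinearMap.ext fun x => V.injective (lp.ext (funext fun j => ?_)),
    fun g i => ContinuousLinearMap.ext fun x => hV g x i, fun A B h => ?_⟩
  · refine Eq.trans ?_ (hV _ _ _).symm
    change V (V.symm (lp.single 2 i (W g x))) j = W g (V (V.symm (lp.single 2 i x)) j)
    rw [V.apply_symm_apply, V.apply_symm_apply]
    obtain rfl | hij := eq_or_ne j i
    · rw [lp.single_apply_self, lp.single_apply_self]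
    · rw [lp.single_apply_ne _ _ _ hij, lp.single_apply_ne _ _ _ hij, map_zero]
  · have hext : A ∘L V' = B ∘L V' :=
      lp.ext_continuousLinearMap (by simp) fun i => ContinuousLinearMap.ext fun x =>
        V.injective (lp.ext (funext fun j => DFunLike.congr_fun (h i j) x))
    refine ContinuousLinearMap.ext fun x => ?_
    rw [← V.symm_apply_apply x]
    exact DFunLike.congr_fun hext (V x)

lemma UnitaryRep.IsMultipleOf.op_mem_doubleCommutant {U : UnitaryRep G H} {W : UnitaryRep G K}
    {S : Set G} {w : G} (hU : U.IsMultipleOf W) (hw : W.op w ∈ doubleCommutant (W.op '' S)) :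
    U.op w ∈ doubleCommutant (U.op '' S) := by
  rw [UnitaryRep.op_mem_doubleCommutant_iff] at hw ⊢
  intro T hT
  obtain ⟨ι, incl, comp, hincl, hcomp, hext⟩ := hU.exists_intertwiners
  have hright : ∀ h i j, comp j ∘L (T * U.op h) ∘L incl i = (comp j ∘L T ∘L incl i) * W.op h :=
    fun h i j => congrArg (fun A => comp j ∘L T ∘L A) (hincl h i).symm
  have hleft : ∀ h i j, comp j ∘L (U.op h * T) ∘L incl i = W.op h * (comp j ∘L T ∘L incl i) :=
    fun h i j => congrArg (fun A => A ∘L T ∘L incl i) (hcomp h j)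
  refine hext _ _ fun i j => ?_
  rw [hright, hleft]
  refine hw _ fun h hh => ?_
  rw [commute_iff_eq, ← hright, ← hleft, (hT h hh).eq]

lemma UnitaryRep.apply_mem_span_orbit (U : UnitaryRep G H) {S : Subgroup G} {v x : H} {k : G}
    (hk : k ∈ S) (hx : x ∈ Submodule.span ℂ (Set.range fun h : S => U h v)) :
    U k x ∈ Submodule.span ℂ (Set.range fun h : S => U h v) := by
  suffices h : (Submodule.span ℂ (Set.range fun h : S => U h v)).map (U k).toLinearEquiv.toLinearMap
      ≤ Submodule.span ℂ (Set.range fun h : S => U h v) from h ⟨x, hx, rfl⟩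
  rw [Submodule.map_span_le]
  rintro _ ⟨l, rfl⟩
  exact Submodule.subset_span ⟨⟨k * l, mul_mem hk l.2⟩, DFunLike.congr_fun (map_mul U k l) v⟩

lemma UnitaryRep.apply_mem_of_invariant {U : UnitaryRep G H} {S : Subgroup G} {w : G}
    (hw : U.op w ∈ doubleCommutant (U.op '' S)) {L : Submodule ℂ H} [L.HasOrthogonalProjection]
    (hL : ∀ h ∈ S, ∀ x ∈ L, U h x ∈ L) {x : H} (hx : x ∈ L) : U w x ∈ L := by
  have hcomm : Commute L.starProjection (U.op w) :=
    op_mem_doubleCommutant_iff.1 hw _ fun h hh => ContinuousLinearMap.ext fun y => by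
      refine Submodule.eq_starProjection_of_mem_orthogonal' (z := U h (y - L.starProjection y))
        (hL h hh _ (L.starProjection_apply_mem y)) (fun l hl => ?_)
        (((congrArg (U h) (add_sub_cancel (L.starProjection y) y)).symm).trans (map_add (U h) _ _))
      rw [U.inner_apply_right]
      exact L.sub_starProjection_mem_orthogonal y _ (hL h⁻¹ (inv_mem hh) l hl)
  rw [← Submodule.starProjection_eq_self_iff] at hx ⊢
  exact (DFunLike.congr_fun hcomm.eq x).trans (congrArg (U w) hx)

lemma UnitaryRep.inner_eq_zero_of_mem_doubleCommutant [CompleteSpace H] {U : UnitaryRep G H}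
    {S : Subgroup G} {w : G} (hw : U.op w ∈ doubleCommutant (U.op '' S)) {a b : H}
    (h : ∀ k ∈ S, ⟪a, U k b⟫_ℂ = 0) : ⟪a, U w b⟫_ℂ = 0 := by
  let L := (Submodule.span ℂ (Set.range fun k : S => U k b)).topologicalClosure
  have : CompleteSpace L := (Submodule.isClosed_topologicalClosure _).completeSpace_coe
  have hb : b ∈ L := Submodule.le_topologicalClosure _
    (Submodule.subset_span ⟨1, DFunLike.congr_fun (map_one U) b⟩)
  have hmem : U w b ∈ L := apply_mem_of_invariant hw (fun k hk _ hx =>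
    map_mem_closure (U k).continuous hx fun _ => U.apply_mem_span_orbit hk) hb
  have horth : L ≤ (ℂ ∙ a)ᗮ := by
    refine Submodule.topologicalClosure_minimal _ (Submodule.span_le.2 ?_)
      (Submodule.isClosed_orthogonal _)
    rintro _ ⟨k, rfl⟩
    exact Submodule.mem_orthogonal_singleton_iff_inner_right.2 (h k k.2)
  exact Submodule.mem_orthogonal_singleton_iff_inner_right.1 (horth hmem)

/-- The direct sum `U ⊕ U`; the difference of two matrix coefficients of `U` is a single matrix
coefficient of it. -/
def doubleRep (U : UnitaryRep G H) : UnitaryRep G (PiLp 2 fun _ : Fin 2 => H) where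
  toFun g := LinearIsometryEquiv.piLpCongrRight 2 fun _ => U g
  map_one' := by
    ext x i
    simp
  map_mul' g h := by
    ext x i
    simp

lemma doubleRep_isMultipleOf (U : UnitaryRep G H) : (doubleRep U).IsMultipleOf U :=
  ⟨Fin 2, (lpPiLpₗᵢ (p := 2) (fun _ : Fin 2 => H) ℂ).symm, fun _ _ _ => rfl⟩

lemma inner_doubleRep (U : UnitaryRep G H) (k : G) (a b c d : H) :
    ⟪!₂[a, -c], doubleRep U k !₂[b, d]⟫_ℂ = ⟪a, U k b⟫_ℂ - ⟪c, U k d⟫_ℂ := by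
  simp [doubleRep, PiLp.inner_apply, sub_eq_add_neg]

lemma UnitaryRep.inner_eq_inner_of_mem_doubleCommutant [CompleteSpace H] {U : UnitaryRep G H}
    {S : Subgroup G} {w : G} (hw : U.op w ∈ doubleCommutant (U.op '' S)) {a b c d : H}
    (h : ∀ k ∈ S, ⟪a, U k b⟫_ℂ = ⟪c, U k d⟫_ℂ) : ⟪a, U w b⟫_ℂ = ⟪c, U w d⟫_ℂ := by
  rw [← sub_eq_zero, ← inner_doubleRep]
  refine inner_eq_zero_of_mem_doubleCommutant
    ((doubleRep_isMultipleOf U).op_mem_doubleCommutant hw) fun k hk => ?_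
  rw [inner_doubleRep, h k hk, sub_self]

end DoubleCommutant

/-! ### Averages of unitary operators -/

section Mean

lemma norm_pow_le_one {E : Type*} [SeminormedAddCommGroup E] [NormedSpace ℂ E] {A : E →L[ℂ] E}
    (hA : ‖A‖ ≤ 1) (k : ℕ) : ‖A ^ k‖ ≤ 1 := by
  induction k with
  | zero => exact ContinuousLinearMap.norm_id_le
  | succ k ih => exact (norm_mul_le _ _).trans (mul_le_one₀ ih (norm_nonneg _) hA)

lemma norm_pow_sub_pow_le {E : Type*} [SeminormedAddCommGroup E] [NormedSpace ℂ E] {A B : E →L[ℂ] E}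
    (hA : ‖A‖ ≤ 1) (hB : ‖B‖ ≤ 1) (k : ℕ) : ‖A ^ k - B ^ k‖ ≤ k * ‖A - B‖ := by
  induction k with
  | zero => simp
  | succ k ih =>
    calc ‖A ^ (k + 1) - B ^ (k + 1)‖ = ‖A * (A ^ k - B ^ k) + (A - B) * B ^ k‖ := by
          rw [pow_succ', pow_succ', mul_sub, sub_mul, sub_add_sub_cancel]
      _ ≤ ‖A‖ * ‖A ^ k - B ^ k‖ + ‖A - B‖ * ‖B ^ k‖ :=
          (norm_add_le _ _).trans (add_le_add (norm_mul_le _ _) (norm_mul_le _ _))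
      _ ≤ 1 * (k * ‖A - B‖) + ‖A - B‖ * 1 := by gcongr; exact norm_pow_le_one hB k
      _ = (k + 1 : ℕ) * ‖A - B‖ := by push_cast; ring

variable {G : Type*} [Group G] {H K : Type*} [NormedAddCommGroup H] [InnerProductSpace ℂ H]
  [NormedAddCommGroup K] [InnerProductSpace ℂ K] {ι : Type*} [Fintype ι]

/-- The average of the unitaries `U(a i)`. -/
def mean (U : UnitaryRep G H) (a : ι → G) : H →L[ℂ] H :=
  (Fintype.card ι : ℂ)⁻¹ • ∑ i, U.op (a i)

lemma mean_apply (U : UnitaryRep G H) (a : ι → G) (x : H) :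
    mean U a x = (Fintype.card ι : ℂ)⁻¹ • ∑ i, U (a i) x := by
  rw [mean, smul_apply, sum_apply]
  rfl

lemma norm_mean_le_one (U : UnitaryRep G H) (a : ι → G) : ‖mean U a‖ ≤ 1 := by
  have hsum : ‖∑ i, U.op (a i)‖ ≤ Fintype.card ι := by
    refine (norm_sum_le_of_le _ fun i _ =>
      (U (a i)).toLinearIsometry.norm_toContinuousLinearMap_le).trans_eq ?_
    rw [Finset.sum_const, Finset.card_univ, nsmul_one]
  rw [mean, norm_smul, norm_inv, Complex.norm_natCast, inv_mul_eq_div]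
  exact div_le_one_of_le₀ hsum (Nat.cast_nonneg _)

lemma commute_mean {U : UnitaryRep G H} {T : H →L[ℂ] H} {a : ι → G}
    (hT : ∀ i, Commute T (U.op (a i))) : Commute T (mean U a) :=
  (Commute.sum_right _ _ _ fun i _ => hT i).smul_right _

lemma norm_le_of_blockwise {J : Type*} (V : H ≃ₗᵢ[ℂ] lp (fun _ : J => K) 2) {A : H →L[ℂ] H}
    {B : K →L[ℂ] K} (h : ∀ x j, V (A x) j = B (V x j)) : ‖A‖ ≤ ‖B‖ := by
  refine A.opNorm_le_bound (norm_nonneg _) fun x => ?_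
  have hle : ‖V (A x)‖ ≤ ‖(‖B‖ : ℂ) • V x‖ := lp.norm_mono (by simp) fun j => by
    rw [h, lp.coeFn_smul, Pi.smul_apply, norm_smul, Complex.norm_real, norm_norm]
    exact B.le_opNorm _
  rwa [V.norm_map, norm_smul, Complex.norm_real, norm_norm, V.norm_map] at hle

lemma UnitaryRep.IsMultipleOf.norm_mean_sub_le {U : UnitaryRep G H} {W : UnitaryRep G K}
    (hU : U.IsMultipleOf W) (a : ι → G) (c : ℂ) : ‖mean U a - c • 1‖ ≤ ‖mean W a - c • 1‖ := by
  obtain ⟨J, V, hV⟩ := hU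
  refine norm_le_of_blockwise V fun x j => ?_
  have hsum : V (∑ i, U (a i) x) j = ∑ i, W (a i) (V x j) := by
    rw [map_sum, lp.coeFn_sum, Finset.sum_apply]
    exact Finset.sum_congr rfl fun i _ => hV _ _ _
  simp only [sub_apply, smul_apply, one_apply_eq_self, mean_apply, map_sub, map_smul,
    lp.coeFn_sub, lp.coeFn_smul, Pi.sub_apply, Pi.smul_apply, hsum]

end Mean

/-! ### Small spatial translations on multiples of `W_{r,n}` -/

section MasslessMean

variable {r : ℝ} {n : Fin 4}

lemma stripFun_sum {ι : Type*} (s : Finset ι) (F : ι → (masslessSections r n).PreL2) (z : ℝ × ℝ) :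
    stripFun (∑ i ∈ s, F i) z = ∑ i ∈ s, stripFun (F i) z :=
  map_sum (AddMonoidHom.mk' (fun f : (masslessSections r n).PreL2 => stripFun f z)
    fun _ _ => rfl) F s

lemma norm_mk_le_of_stripFun {f g : (masslessSections r n).PreL2} {δ : ℝ}
    (hδ : 0 ≤ δ) (h : ∀ z, ‖stripFun f z‖ ≤ δ * ‖stripFun g z‖) :
    ‖(SeparationQuotient.mk f : InducedSpace (stabChar r n) orbitMeasure)‖
      ≤ δ * ‖(SeparationQuotient.mk g : InducedSpace (stabChar r n) orbitMeasure)‖ := by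
  have hle := eLpNorm_le_mul_eLpNorm_of_ae_le_mul (p := 2) (μ := stripMeasure)
    (Eventually.of_forall h)
  rw [← enorm_eq_eLpNorm_stripFun, ← enorm_eq_eLpNorm_stripFun] at hle
  rw [← ofReal_norm f, ← ofReal_norm g, ← ENNReal.ofReal_mul hδ,
    ENNReal.ofReal_le_ofReal_iff (by positivity)] at hle
  rwa [SeparationQuotient.norm_mk, SeparationQuotient.norm_mk]

lemma exists_mean_transG {ι : Type*} [Fintype ι] (a : ι → Minkowski)
    (f : (masslessSections r n).PreL2) :
    ∃ f' : (masslessSections r n).PreL2,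
      mean (masslessRep r n) (fun i => transG (a i)) (SeparationQuotient.mk f)
        = SeparationQuotient.mk f' ∧
      ∀ z, stripFun f' z = (Fintype.card ι : ℂ)⁻¹ *
        (∑ i, Complex.exp (⟪momentum r z, WithLp.toLp 2 (a i)⟫_ℝ * Complex.I)) * stripFun f z := by
  choose F hmk hF using fun i => exists_masslessRep_transG (a i) f
  refine ⟨(Fintype.card ι : ℂ)⁻¹ • ∑ i, F i, ?_, fun z => ?_⟩
  · rw [mean_apply]
    simp only [hmk]
    exact congrArg _ (map_sum (SeparationQuotient.mkCLM ℂ (masslessSections r n).PreL2) F _).symm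
  · rw [stripFun_smul, stripFun_sum, Finset.sum_congr rfl fun i _ => hF i z, ← Finset.sum_mul,
      mul_assoc]

lemma norm_mean_transG_sub_le {ι : Type*} [Fintype ι] (a : ι → Minkowski) {c : ℂ} {δ : ℝ}
    (hδ : 0 ≤ δ)
    (h : ∀ z, ‖(Fintype.card ι : ℂ)⁻¹ *
      (∑ i, Complex.exp (⟪momentum r z, WithLp.toLp 2 (a i)⟫_ℝ * Complex.I)) - c‖ ≤ δ) :
    ‖mean (masslessRep r n) (fun i => transG (a i)) - c • 1‖ ≤ δ := by
  refine ContinuousLinearMap.opNorm_le_bound _ hδ fun x => ?_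
  obtain ⟨f, rfl⟩ := SeparationQuotient.surjective_mk x
  obtain ⟨f', hmk, hf'⟩ := exists_mean_transG a f
  rw [sub_apply, hmk]
  refine norm_mk_le_of_stripFun (f := f' - c • f) hδ fun z => ?_
  rw [stripFun_sub, stripFun_smul, hf', ← sub_mul, norm_mul]
  exact mul_le_mul_of_nonneg_right (h z) (norm_nonneg _)

/-- The four translations by `±ε` along the axes of the `(x₁, x₂)`-plane. -/
def spatialSteps (ε : ℝ) : Fin 4 → Minkowski :=
  ![Pi.single 1 ε, -Pi.single 1 ε, Pi.single 2 ε, -Pi.single 2 ε]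

lemma average_exp_momentum (r ε : ℝ) (z : ℝ × ℝ) :
    (Fintype.card (Fin 4) : ℂ)⁻¹ *
      (∑ i, Complex.exp (⟪momentum r z, WithLp.toLp 2 (spatialSteps ε i)⟫_ℝ * Complex.I))
    = ((Real.cos (ε * r * Real.cos z.2) + Real.cos (ε * r * Real.sin z.2)) / 2 : ℝ) := by
  have hinner (i : Fin 4) : ⟪momentum r z, WithLp.toLp 2 (spatialSteps ε i)⟫_ℝ
      = ![-(ε * r * Real.cos z.2), ε * r * Real.cos z.2, ε * r * Real.sin z.2,
          -(ε * r * Real.sin z.2)] i := by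
    rw [inner_momentum]
    fin_cases i <;> simp [spatialSteps] <;> ring
  simp only [hinner, Fin.sum_univ_four, Fintype.card_fin, Matrix.cons_val]
  rw [Complex.ofReal_div, Complex.ofReal_add, Complex.ofReal_cos (ε * r * _),
    Complex.ofReal_cos (ε * r * _), Complex.cos, Complex.cos]
  push_cast
  ring

lemma abs_cos_mul_sub_le {y c : ℝ} (hy : |y| ≤ 1) (hc : |c| ≤ 1) :
    |Real.cos (y * c) - (1 - (y * c) ^ 2 / 2)| ≤ y ^ 4 * (5 / 96) := by
  have hyc : |y * c| ≤ |y| := by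
    rw [abs_mul]
    exact mul_le_of_le_one_right (abs_nonneg _) hc
  calc |Real.cos (y * c) - (1 - (y * c) ^ 2 / 2)| ≤ |y * c| ^ 4 * (5 / 96) :=
        Real.cos_bound (hyc.trans hy)
    _ ≤ |y| ^ 4 * (5 / 96) := by gcongr
    _ = y ^ 4 * (5 / 96) := by rw [Even.pow_abs (by decide)]

lemma abs_cos_average_sub_exp_le {y : ℝ} (θ : ℝ) (hy : |y| ≤ 1) :
    |(Real.cos (y * Real.cos θ) + Real.cos (y * Real.sin θ)) / 2 - Real.exp (-(y ^ 2 / 4))|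
      ≤ y ^ 4 := by
  have hcos := abs_cos_mul_sub_le hy (Real.abs_cos_le_one θ)
  have hsin := abs_cos_mul_sub_le hy (Real.abs_sin_le_one θ)
  have hexp : |Real.exp (-(y ^ 2 / 4)) - 1 - -(y ^ 2 / 4)| ≤ y ^ 4 / 16 := by
    refine (Real.abs_exp_sub_one_sub_id_le ?_).trans_eq (by ring)
    have hy2 : y ^ 2 ≤ 1 := (sq_le_one_iff_abs_le_one y).2 hy
    rw [abs_neg, abs_of_nonneg (by positivity)]
    linarith
  have hpyth : (y * Real.cos θ) ^ 2 + (y * Real.sin θ) ^ 2 = y ^ 2 := by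
    linear_combination y ^ 2 * Real.sin_sq_add_cos_sq θ
  have hy4 : 0 ≤ y ^ 4 := by positivity
  rw [abs_le] at hcos hsin hexp ⊢
  constructor <;> linarith

lemma norm_mean_spatialSteps_sub_le {ε : ℝ} (h : |ε * r| ≤ 1) :
    ‖mean (masslessRep r n) (fun i => transG (spatialSteps ε i))
      - (Real.exp (-((ε * r) ^ 2 / 4)) : ℂ) • 1‖ ≤ (ε * r) ^ 4 := by
  refine norm_mean_transG_sub_le _ (by positivity) fun z => ?_
  rw [average_exp_momentum, ← Complex.ofReal_sub, Complex.norm_real]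
  exact abs_cos_average_sub_exp_le z.2 h

lemma norm_mean_spatialSteps_pow_sub_le {H : Type*} [NormedAddCommGroup H] [InnerProductSpace ℂ H]
    {U : UnitaryRep Gt3 H} (hU : U.IsMultipleOf (masslessRep r n)) (m : ℕ) {k : ℕ} (hk : 0 < k)
    (hrk : |r| ≤ k) :
    ‖mean U (fun i => transG (spatialSteps (k : ℝ)⁻¹ i)) ^ (k ^ 2 * m)
      - (Real.exp (-(r ^ 2 / 4)) : ℂ) ^ m • 1‖ ≤ m * r ^ 4 / k ^ 2 := by
  have hk' : (0 : ℝ) < k := Nat.cast_pos.2 hk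
  have hstep : |(k : ℝ)⁻¹ * r| ≤ 1 := by
    rw [abs_mul, abs_inv, abs_of_pos hk', inv_mul_eq_div]
    exact div_le_one_of_le₀ hrk hk'.le
  set c : ℂ := (Real.exp (-(((k : ℝ)⁻¹ * r) ^ 2 / 4)) : ℂ)
  have hc : ‖c • (1 : H →L[ℂ] H)‖ ≤ 1 := by
    have hone : ‖(1 : H →L[ℂ] H)‖ ≤ 1 := ContinuousLinearMap.norm_id_le
    refine (norm_smul_le _ _).trans (mul_le_one₀ ?_ (norm_nonneg _) hone)
    rw [Complex.norm_real, Real.norm_of_nonneg (Real.exp_pos _).le, Real.exp_le_one_iff]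
    exact neg_nonpos.2 (by positivity)
  have hpow : c ^ (k ^ 2 * m) = (Real.exp (-(r ^ 2 / 4)) : ℂ) ^ m := by
    rw [pow_mul, ← Complex.ofReal_pow, ← Real.exp_nat_mul]
    congr 3
    push_cast
    field_simp
  calc ‖mean U (fun i => transG (spatialSteps (k : ℝ)⁻¹ i)) ^ (k ^ 2 * m)
        - (Real.exp (-(r ^ 2 / 4)) : ℂ) ^ m • 1‖
      = ‖mean U (fun i => transG (spatialSteps (k : ℝ)⁻¹ i)) ^ (k ^ 2 * m)
          - (c • 1) ^ (k ^ 2 * m)‖ := by rw [smul_pow, one_pow, hpow]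
    _ ≤ (k ^ 2 * m : ℕ) * ‖mean U (fun i => transG (spatialSteps (k : ℝ)⁻¹ i)) - c • 1‖ :=
        norm_pow_sub_pow_le (norm_mean_le_one _ _) hc _
    _ ≤ (k ^ 2 * m : ℕ) * ((k : ℝ)⁻¹ * r) ^ 4 := by
        gcongr
        exact (hU.norm_mean_sub_le _ _).trans (norm_mean_spatialSteps_sub_le hstep)
    _ = m * r ^ 4 / k ^ 2 := by
        push_cast
        field_simp

/-- A central limit: the average over the four steps multiplies by a function of the momentum
whose second order term, after scaling, only depends on `r`. -/
lemma tendsto_mean_spatialSteps_pow {H : Type*} [NormedAddCommGroup H] [InnerProductSpace ℂ H]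
    {U : UnitaryRep Gt3 H} (hU : U.IsMultipleOf (masslessRep r n)) (m : ℕ) :
    Tendsto (fun k : ℕ => mean U (fun i => transG (spatialSteps (k : ℝ)⁻¹ i)) ^ (k ^ 2 * m)) atTop
      (𝓝 ((Real.exp (-(r ^ 2 / 4)) : ℂ) ^ m • 1)) := by
  rw [tendsto_iff_norm_sub_tendsto_zero]
  have hlim : Tendsto (fun k : ℕ => m * r ^ 4 / (k : ℝ) ^ 2) atTop (𝓝 0) :=
    tendsto_const_nhds.div_atTop
      ((tendsto_pow_atTop two_ne_zero).comp tendsto_natCast_atTop_atTop)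
  refine squeeze_zero' (Eventually.of_forall fun _ => norm_nonneg _) ?_ hlim
  filter_upwards [eventually_gt_atTop 0, eventually_ge_atTop ⌈|r|⌉₊] with k hk hrk
  exact norm_mean_spatialSteps_pow_sub_le hU m hk (Nat.ceil_le.1 hrk)

end MasslessMean

/-! ### Operators on direct integrals -/

namespace MeasurableField

variable {X : Type*} [MeasurableSpace X] {μ : Measure X} {E : X → Type*}
  [∀ x, NormedAddCommGroup (E x)] [∀ x, InnerProductSpace ℂ (E x)] {𝓔 : MeasurableField μ E}

/-- The value at `x` of a square-integrable measurable vector field. -/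
def eval (s : 𝓔.sectionSpace.PreL2) (x : X) : E x :=
  𝓔.sectionSpace.ev (𝓔.sectionSpace.sec s) x

lemma eval_sum {ι : Type*} (S : Finset ι) (s : ι → 𝓔.sectionSpace.PreL2) (x : X) :
    eval (∑ i ∈ S, s i) x = ∑ i ∈ S, eval (s i) x :=
  map_sum (AddMonoidHom.mk' (fun s : 𝓔.sectionSpace.PreL2 => eval s x) fun _ _ => rfl) s S

lemma inner_mk_mk (s t : 𝓔.sectionSpace.PreL2) :
    ⟪(SeparationQuotient.mk s : 𝓔.directIntegral), SeparationQuotient.mk t⟫_ℂ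
      = ∫ x, ⟪eval s x, eval t x⟫_ℂ ∂μ :=
  SeparationQuotient.inner_mk_mk s t

lemma integrable_inner_eval (s t : 𝓔.sectionSpace.PreL2) :
    Integrable (fun x => ⟪eval s x, eval t x⟫_ℂ) μ :=
  𝓔.sectionSpace.integrable_inner s t

lemma memLp_norm_eval (s : 𝓔.sectionSpace.PreL2) : MemLp (fun x => ‖eval s x‖) 2 μ :=
  (memLp_two_iff_integrable_sq (𝓔.sectionSpace.aemeasurable_norm _).aestronglyMeasurable).2
    (𝓔.sectionSpace.integrable_sq (𝓔.sectionSpace.energy_sec_lt s))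

/-- The operator `A` is the direct integral `∫^⊕ a x dμ(x)` of the operators `a x`. -/
def IsDirectIntegral (A : 𝓔.directIntegral →L[ℂ] 𝓔.directIntegral) (a : ∀ x, E x →L[ℂ] E x) :
    Prop :=
  ∀ s : 𝓔.sectionSpace.PreL2, ∃ s' : 𝓔.sectionSpace.PreL2,
    A (SeparationQuotient.mk s) = SeparationQuotient.mk s' ∧ ∀ x, eval s' x = a x (eval s x)

lemma IsDirectIntegral.pow {A : 𝓔.directIntegral →L[ℂ] 𝓔.directIntegral} {a : ∀ x, E x →L[ℂ] E x}
    (hA : IsDirectIntegral A a) (k : ℕ) : IsDirectIntegral (A ^ k) fun x => a x ^ k := by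
  intro s
  induction k with
  | zero => exact ⟨s, rfl, fun _ => rfl⟩
  | succ k ih =>
    obtain ⟨s', hmk', hs'⟩ := ih
    obtain ⟨s'', hmk'', hs''⟩ := hA s'
    refine ⟨s'', ?_, fun x => ?_⟩
    · rw [pow_succ', ← hmk'', ← hmk']
      rfl
    · exact (hs'' x).trans ((congrArg (a x) (hs' x)).trans
        (DFunLike.congr_fun (pow_succ' (a x) k) _).symm)

section Representation

variable {G : Type*} [Group G] {U : ∀ x, UnitaryRep G (E x)} (hU : 𝓔.IsMeasurableRep U)

lemma isDirectIntegral_op (g : G) :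
    IsDirectIntegral ((𝓔.directIntegralRep U hU).op g) fun x => (U x).op g := fun _ =>
  ⟨_, rfl, fun _ => rfl⟩

lemma isDirectIntegral_mean {ι : Type*} [Fintype ι] (a : ι → G) :
    IsDirectIntegral (mean (𝓔.directIntegralRep U hU) a) fun x => mean (U x) a := by
  intro s
  choose F hmk hF using fun i => isDirectIntegral_op hU (a i) s
  refine ⟨(Fintype.card ι : ℂ)⁻¹ • ∑ i, F i, ?_, fun x => ?_⟩
  · rw [mean_apply]
    exact congrArg (_ • ·) ((Finset.sum_congr rfl fun i _ => hmk i).trans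
      (map_sum (SeparationQuotient.mkCLM ℂ 𝓔.sectionSpace.PreL2) F _).symm)
  · rw [mean_apply]
    exact congrArg ((Fintype.card ι : ℂ)⁻¹ • · : E x → E x)
      ((eval_sum _ F x).trans (Finset.sum_congr rfl fun i _ => hF i x))

lemma directIntegralRep_comp {K : Type*} [Group K] (φ : K →* G) :
    𝓔.directIntegralRep (fun x => (U x).comp φ) (fun k => hU (φ k))
      = (𝓔.directIntegralRep U hU).comp φ :=
  MonoidHom.ext fun _ => LinearIsometryEquiv.ext fun _ => rfl

end Representation

lemma tendsto_inner_of_isDirectIntegral {A : ℕ → 𝓔.directIntegral →L[ℂ] 𝓔.directIntegral}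
    {a : ℕ → ∀ x, E x →L[ℂ] E x} (hA : ∀ N, IsDirectIntegral (A N) (a N))
    (ha : ∀ N x, ‖a N x‖ ≤ 1) {f : X → ℂ}
    (hlim : ∀ᵐ x ∂μ, Tendsto (fun N => a N x) atTop (𝓝 (f x • 1)))
    (s t : 𝓔.sectionSpace.PreL2) :
    Tendsto (fun N => ⟪(SeparationQuotient.mk s : 𝓔.directIntegral),
        A N (SeparationQuotient.mk t)⟫_ℂ) atTop
      (𝓝 (∫ x, f x * ⟪eval s x, eval t x⟫_ℂ ∂μ)) := by
  choose p hmk hp using fun N => hA N t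
  simp only [hmk, inner_mk_mk]
  refine tendsto_integral_of_dominated_convergence (fun x => ‖eval s x‖ * ‖eval t x‖)
    (fun N => (integrable_inner_eval s (p N)).aestronglyMeasurable)
    ((memLp_norm_eval s).integrable_mul (memLp_norm_eval t))
    (fun N => Eventually.of_forall fun x => ?_) ?_
  · rw [hp]
    refine (norm_inner_le_norm _ _).trans ?_
    gcongr
    exact (a N x).le_of_opNorm_le_of_le (ha N x) le_rfl |>.trans_eq (one_mul _)
  · filter_upwards [hlim] with x hx
    simp only [hp, ← inner_smul_right]
    exact tendsto_const_nhds.inner (((ContinuousLinearMap.apply ℂ _ (eval t x)).continuous.tendsto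
      _).comp hx)

/-- The matrix coefficients of `T` and of its adjoint agree in each fibre; this is how it is used
that an operator commuting with the diagonal operators is decomposable. -/
def IsFibrewise [∀ x, CompleteSpace (E x)] (T : 𝓔.directIntegral →L[ℂ] 𝓔.directIntegral) : Prop :=
  ∀ ⦃s s' t t' : 𝓔.sectionSpace.PreL2⦄,
    ContinuousLinearMap.adjoint T (SeparationQuotient.mk s) = SeparationQuotient.mk s' →
    T (SeparationQuotient.mk t) = SeparationQuotient.mk t' →
    ∀ᵐ x ∂μ, ⟪eval s' x, eval t x⟫_ℂ = ⟪eval s x, eval t' x⟫_ℂ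

variable [∀ x, CompleteSpace (E x)] {T : 𝓔.directIntegral →L[ℂ] 𝓔.directIntegral}

lemma isFibrewise_of_tendsto_pow [StandardBorelSpace X] {u : X → ℝ} (hu : Measurable u)
    (hinj : Function.Injective u) {C : ℝ} (hC : ∀ x, |u x| ≤ C)
    {A : ℕ → ℕ → 𝓔.directIntegral →L[ℂ] 𝓔.directIntegral} {a : ℕ → ℕ → ∀ x, E x →L[ℂ] E x}
    (hA : ∀ m N, IsDirectIntegral (A m N) (a m N)) (ha : ∀ m N x, ‖a m N x‖ ≤ 1)
    (hlim : ∀ m, ∀ᵐ x ∂μ, Tendsto (fun N => a m N x) atTop (𝓝 ((u x : ℂ) ^ m • 1)))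
    (hT : ∀ m N, Commute T (A m N)) : IsFibrewise T := by
  intro s s' t t' hs ht
  have hF : Integrable (fun x => ⟪eval s' x, eval t x⟫_ℂ - ⟪eval s x, eval t' x⟫_ℂ) μ :=
    (integrable_inner_eval s' t).sub (integrable_inner_eval s t')
  suffices hzero : ∀ m : ℕ, ∫ x, (u x : ℂ) ^ m *
      (⟪eval s' x, eval t x⟫_ℂ - ⟪eval s x, eval t' x⟫_ℂ) ∂μ = 0 by
    filter_upwards [ae_eq_zero_of_integral_pow hu hinj hC hF hzero] with x hx
    exact sub_eq_zero.1 hx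
  intro m
  have hint (p q : 𝓔.sectionSpace.PreL2) :
      Integrable (fun x => (u x : ℂ) ^ m * ⟪eval p x, eval q x⟫_ℂ) μ := by
    refine (integrable_inner_eval p q).bdd_mul (c := C ^ m) (by fun_prop)
      (Eventually.of_forall fun x => ?_)
    rw [norm_pow, Complex.norm_real]
    exact pow_le_pow_left₀ (norm_nonneg _) (hC x) m
  have hcoeff (N : ℕ) : ⟪(SeparationQuotient.mk s' : 𝓔.directIntegral),
      A m N (SeparationQuotient.mk t)⟫_ℂ
        = ⟪(SeparationQuotient.mk s : 𝓔.directIntegral), A m N (SeparationQuotient.mk t')⟫_ℂ := by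
    rw [← hs, ← ht, ContinuousLinearMap.adjoint_inner_left]
    exact congrArg _ (DFunLike.congr_fun (hT m N).eq _)
  have hlim' := tendsto_inner_of_isDirectIntegral (hA m) (ha m) (hlim m) s' t
  simp only [hcoeff] at hlim'
  have heq := tendsto_nhds_unique hlim'
    (tendsto_inner_of_isDirectIntegral (hA m) (ha m) (hlim m) s t')
  simp only [mul_sub]
  rw [integral_sub (hint s' t) (hint s t'), heq, sub_self]

lemma commute_op_directIntegralRep {G : Type*} [Group G] {U : ∀ x, UnitaryRep G (E x)}
    (hU : 𝓔.IsMeasurableRep U) (hT : IsFibrewise T) {Q : Subgroup G} [Countable Q]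
    (hTQ : ∀ h ∈ Q, Commute T ((𝓔.directIntegralRep U hU).op h)) {w : G}
    (hw : ∀ᵐ x ∂μ, (U x).op w ∈ doubleCommutant ((U x).op '' Q)) :
    Commute T ((𝓔.directIntegralRep U hU).op w) := by
  refine ContinuousLinearMap.ext fun x => ext_inner_left ℂ fun y => ?_
  obtain ⟨t, rfl⟩ := SeparationQuotient.surjective_mk x
  obtain ⟨s, rfl⟩ := SeparationQuotient.surjective_mk y
  obtain ⟨t', ht⟩ := SeparationQuotient.surjective_mk (T (SeparationQuotient.mk t))
  obtain ⟨s', hs⟩ := SeparationQuotient.surjective_mk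
    (ContinuousLinearMap.adjoint T (SeparationQuotient.mk s))
  have hQ : ∀ᵐ x ∂μ, ∀ h : Q,
      ⟪eval s' x, U x h (eval t x)⟫_ℂ = ⟪eval s x, U x h (eval t' x)⟫_ℂ := by
    refine ae_all_iff.2 fun h => ?_
    obtain ⟨p, hmk, hp⟩ := isDirectIntegral_op hU (h : G) t
    obtain ⟨p', hmk', hp'⟩ := isDirectIntegral_op hU (h : G) t'
    have hTp : T (SeparationQuotient.mk p) = SeparationQuotient.mk p' := by
      rw [← hmk, ← hmk', ht]
      exact DFunLike.congr_fun (hTQ h h.2).eq _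
    filter_upwards [hT hs.symm hTp] with x hx
    rwa [hp, hp'] at hx
  obtain ⟨p, hmk, hp⟩ := isDirectIntegral_op hU w t
  obtain ⟨p', hmk', hp'⟩ := isDirectIntegral_op hU w t'
  simp only [mul_apply_eq_comp]
  rw [← ContinuousLinearMap.adjoint_inner_left, ← hs, ← ht, hmk, hmk', inner_mk_mk, inner_mk_mk]
  refine integral_congr_ae ?_
  filter_upwards [hQ, hw] with x hx hwx
  rw [hp, hp']
  exact UnitaryRep.inner_eq_inner_of_mem_doubleCommutant hwx fun k hk => hx ⟨k, hk⟩

end MeasurableField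

/-! ### Wedges -/

/-- The countable subgroup of `G₃` generated by the translations with rational coordinates and the
boost-rotations of `W₃` with rational parameters. -/
def rationalSubgroup : Subgroup Gt3 :=
  Subgroup.closure (Set.range fun p : (Fin 4 → ℚ) ⊕ (ℚ × ℚ) =>
    p.elim (fun q => transG fun i => q i) fun s => boostRotG s.1 s.2)

instance : Countable rationalSubgroup := by
  rw [rationalSubgroup, ← FreeGroup.range_lift_eq_closure]
  exact (Set.countable_range _).to_subtype

lemma transG_mem_rationalSubgroup (q : Fin 4 → ℚ) :
    transG (fun i => q i) ∈ rationalSubgroup :=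
  Subgroup.subset_closure ⟨Sum.inl q, rfl⟩

lemma boostRotG_mem_rationalSubgroup (s : ℚ × ℚ) : boostRotG s.1 s.2 ∈ rationalSubgroup :=
  Subgroup.subset_closure ⟨Sum.inr s, rfl⟩

lemma transG_spatialSteps_mem_rationalSubgroup (q : ℚ) (i : Fin 4) :
    transG (spatialSteps q i) ∈ rationalSubgroup := by
  convert transG_mem_rationalSubgroup
    ((![Pi.single 1 q, -Pi.single 1 q, Pi.single 2 q, -Pi.single 2 q] : Fin 4 → Fin 4 → ℚ) i)
    using 2
  ext j
  fin_cases i <;> fin_cases j <;> simp [spatialSteps]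

lemma coe_mem_G3_of_mem_rationalSubgroup {k : Gt3} (hk : k ∈ rationalSubgroup) :
    (k : Poincare) ∈ G3 := by
  suffices rationalSubgroup ≤ G3.subgroupOf Gt3 from this hk
  rw [rationalSubgroup, Subgroup.closure_le]
  rintro _ ⟨q | s, rfl⟩
  · exact one_mem G30
  · exact boostRot_mem _ _

lemma masslessRep_op_mem_doubleCommutant {r : ℝ} (hr : r ≠ 0) (n : Fin 4) (w : Gt3) :
    (masslessRep r n).op w ∈ doubleCommutant ((masslessRep r n).op '' rationalSubgroup) := by
  refine UnitaryRep.op_mem_doubleCommutant_iff.2 fun S hS => ?_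
  obtain ⟨c, rfl⟩ := exists_eq_smul_one_of_commute hr
    (fun q => hS _ (transG_mem_rationalSubgroup q))
    (fun s => hS _ (boostRotG_mem_rationalSubgroup s))
  exact (Commute.one_left _).smul_left c

section DirectIntegral

variable {μ : Measure (Set.Ioi (0 : ℝ))} {E : Set.Ioi (0 : ℝ) → Type*}
  [∀ r, NormedAddCommGroup (E r)] [∀ r, InnerProductSpace ℂ (E r)] [∀ r, CompleteSpace (E r)]
  {𝓔 : MeasurableField μ E} {U : ∀ r, UnitaryRep Gt3 (E r)} {hU : 𝓔.IsMeasurableRep U}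
  {T : 𝓔.directIntegral →L[ℂ] 𝓔.directIntegral}

lemma isFibrewise_of_commute_rationalSubgroup
    (hmult : ∀ᵐ r ∂μ, ∃ n : Fin 4, (U r).IsMultipleOf (masslessRep r n))
    (hT : ∀ h ∈ rationalSubgroup, Commute T ((𝓔.directIntegralRep U hU).op h)) :
    MeasurableField.IsFibrewise T := by
  have := (measurableSet_Ioi (a := (0 : ℝ))).standardBorel
  have hinj : Function.Injective fun r : Set.Ioi (0 : ℝ) => Real.exp (-((r : ℝ) ^ 2 / 4)) :=
    fun r₁ r₂ h => Subtype.ext <| (sq_eq_sq₀ r₁.2.le r₂.2.le).1 <| by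
      linarith [Real.exp_injective h]
  have hbound (r : Set.Ioi (0 : ℝ)) : |Real.exp (-((r : ℝ) ^ 2 / 4))| ≤ 1 := by
    rw [Real.abs_exp, Real.exp_le_one_iff]
    exact neg_nonpos.2 (by positivity)
  refine MeasurableField.isFibrewise_of_tendsto_pow (by fun_prop) hinj hbound
    (fun m k => (MeasurableField.isDirectIntegral_mean hU
      fun i => transG (spatialSteps (k : ℝ)⁻¹ i)).pow (k ^ 2 * m))
    (fun m k r => norm_pow_le_one (norm_mean_le_one _ _) _) (fun m => ?_) fun m k => ?_
  · filter_upwards [hmult] with r ⟨n, hn⟩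
    exact tendsto_mean_spatialSteps_pow hn m
  · refine (commute_mean fun i => hT _ ?_).pow_right _
    simpa only [Rat.cast_inv, Rat.cast_natCast] using
      transG_spatialSteps_mem_rationalSubgroup (k : ℚ)⁻¹ i

lemma directIntegralRep_op_mem_doubleCommutant
    (hmult : ∀ᵐ r ∂μ, ∃ n : Fin 4, (U r).IsMultipleOf (masslessRep r n)) (w : Gt3) :
    (𝓔.directIntegralRep U hU).op w
      ∈ doubleCommutant ((𝓔.directIntegralRep U hU).op '' rationalSubgroup) := by
  refine UnitaryRep.op_mem_doubleCommutant_iff.2 fun T hT => ?_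
  refine MeasurableField.commute_op_directIntegralRep hU
    (isFibrewise_of_commute_rationalSubgroup hmult hT) hT ?_
  filter_upwards [hmult] with r ⟨n, hn⟩
  exact hn.op_mem_doubleCommutant (masslessRep_op_mem_doubleCommutant r.2.ne' n w)

end DirectIntegral

/-- Conjugation by `g`, which identifies `G̃₃` with `G̃_W` for the wedge `W = g W₃`. -/
def conjGtW (g : Poincare) : Gt3 ≃* GtW g :=
  (MulAut.conj g).subgroupMap Gt3

lemma masslessRepW_conjGtW (g : Poincare) (r : ℝ) (n : Fin 4) (k : Gt3) :
    masslessRepW g r n (conjGtW g k) = masslessRep r n k :=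
  congrArg (masslessRep r n) ((conjGtW g).symm_apply_apply k)

lemma UnitaryRep.IsMultipleOf.comp_conjGtW {H : Type*} [NormedAddCommGroup H]
    [InnerProductSpace ℂ H] {g : Poincare} {r : ℝ} {n : Fin 4} {U : UnitaryRep (GtW g) H}
    (hU : U.IsMultipleOf (masslessRepW g r n)) :
    UnitaryRep.IsMultipleOf (U.comp (conjGtW g).toMonoidHom) (masslessRep r n) := by
  obtain ⟨ι, V, hV⟩ := hU
  refine ⟨ι, V, fun k v i => (hV (conjGtW g k) v i).trans ?_⟩
  rw [masslessRepW_conjGtW]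

lemma coe_conjGtW_mem_GW (g : Poincare) {k : Gt3} (hk : k ∈ rationalSubgroup) :
    (conjGtW g k : Poincare) ∈ GW g :=
  Subgroup.mem_map_of_mem _ (coe_mem_G3_of_mem_rationalSubgroup hk)

lemma doubleCommutant_mono {H : Type*} [NormedAddCommGroup H] [InnerProductSpace ℂ H]
    {S S' : Set (H →L[ℂ] H)} (h : S ⊆ S') : doubleCommutant S ⊆ doubleCommutant S' :=
  Set.centralizer_subset (Set.centralizer_subset h)

end MasslessMC

end

theorem proposition4p4 (g : MasslessMC.Poincare) (μ : Measure (Set.Ioi (0 : ℝ)))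
    (E : Set.Ioi (0 : ℝ) → Type*) [∀ r, NormedAddCommGroup (E r)]
    [∀ r, InnerProductSpace ℂ (E r)] [∀ r, CompleteSpace (E r)]
    (𝓔 : MasslessMC.MeasurableField μ E)
    (U : ∀ r, MasslessMC.UnitaryRep (MasslessMC.GtW g) (E r)) (hU : 𝓔.IsMeasurableRep U)
    (hmult : ∀ᵐ r ∂μ, ∃ n : Fin 4, (U r).IsMultipleOf (MasslessMC.masslessRepW g r n)) :
    MasslessMC.ModularityCondition g (𝓔.directIntegralRep U hU) := by
  intro w _
  obtain ⟨k, rfl⟩ := (MasslessMC.conjGtW g).surjective w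
  have hmult₃ : ∀ᵐ r ∂μ, ∃ n : Fin 4, MasslessMC.UnitaryRep.IsMultipleOf
      ((U r).comp (MasslessMC.conjGtW g).toMonoidHom) (MasslessMC.masslessRep r n) :=
    hmult.mono fun r ⟨n, hn⟩ => ⟨n, hn.comp_conjGtW⟩
  have hk := MasslessMC.directIntegralRep_op_mem_doubleCommutant
    (hU := fun k => hU (MasslessMC.conjGtW g k)) hmult₃ k
  rw [MasslessMC.MeasurableField.directIntegralRep_comp hU] at hk
  refine MasslessMC.doubleCommutant_mono ?_ hk
  rintro _ ⟨h, hh, rfl⟩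
  exact ⟨MasslessMC.conjGtW g h, MasslessMC.coe_conjGtW_mem_GW g hh, rfl⟩
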